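/- For complex $\gamma$ with $\operatorname{Re}\gamma>0$ and $z$ with $|\operatorname{Re} z|<\pi+\operatorname{Re}\gamma$, the quantum dilogarithm is $$S_\gamma(z)=\exp\left(\frac14\int_{C_R}\frac{e^{zt}}{\sinh(\pi t)\,\sinh(\gamma t)}\,\frac{dt}{t}\right),$$ where $0<R<\min\{\pi/|\gamma|,1\}$ and $C_R=(-\infty,-R]\cup\Omega_R\cup[R,\infty)$, traversed from left to right, with the upper semicircle $\Omega_R=\{R e^{i(\pi-s)} : 0\le s\le\pi\}$; the value does not depend on the choice of $R$. Let $n\ge 2$ be an even integer, let $u>0$ be real and put $\xi=2\pi i+u$. For each integer $N\ge 1$ put $\gamma=\gamma_N=\dfrac{2\pi-iu}{2(N+n-2)}$. Then both points $-\pi-iu+\gamma$ and $\pi-iu-(2n-3)\gamma$ lie in the strip $|\operatorname{Re} z|<\pi+\operatorname{Re}\gamma$, the integrals defining $S_\gamma$ there converge absolutely, and, whatever admissible radii are used in the numerator and in the denominator, $$\frac{S_{\gamma}(-\pi-iu+\gamma)}{S_{\gamma}(\pi-iu-(2n-3)\gamma)}=\frac{e^{u\pi/\gamma}-1}{\prod_{k=0}^{n-2}\left(e^{u-2k\gamma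 i}-1\right)} .$$ Moreover, with $n$ and $u$ fixed, $$\frac{S_{\gamma}(-\pi-iu+\gamma)}{S_{\gamma}(\pi-iu-(2n-3)\gamma)}\ \sim\ \frac{e^{2\pi i u(N+n-2)/\xi}}{(e^{u}-1)^{n-1}}\qquad(N\to\infty),$$ that is, the quotient of the two sides tends to $1$. -/

import Mathlib

open scoped Real
open Filter Asymptotics MeasureTheory

namespace QDilog

noncomputable section

/-- The point `R e^{i(π - s)}`, `0 ≤ s ≤ π`, of the upper semicircle `Ω_R`, which runs
from `-R` to `R`. -/
def arc (R s : ℝ) : ℂ := (R : ℂ) * Complex.exp (Complex.I * ((π : ℂ) - (s : ℂ)))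

/-- The integrand `f(Ω_R(s)) Ω_R'(s)` of the part of the contour integral along the semicircle. -/
def arcIntegrand (R : ℝ) (f : ℂ → ℂ) (s : ℝ) : ℂ := f (arc R s) * (-Complex.I * arc R s)

/-- The integral of `f` along the contour `C_R = (-∞, -R] ∪ Ω_R ∪ [R, ∞)`. -/
def contourIntegral (R : ℝ) (f : ℂ → ℂ) : ℂ :=
  (∫ t in Set.Iic (-R), f (t : ℂ)) + (∫ s in (0 : ℝ)..π, arcIntegrand R f s)
    + ∫ t in Set.Ici R, f (t : ℂ)

/-- The integral of `f` along `C_R` converges absolutely on each of the three pieces. -/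
def ContourIntegrable (R : ℝ) (f : ℂ → ℂ) : Prop :=
  IntegrableOn (fun t : ℝ => f (t : ℂ)) (Set.Iic (-R)) ∧
    IntervalIntegrable (arcIntegrand R f) volume 0 π ∧
      IntegrableOn (fun t : ℝ => f (t : ℂ)) (Set.Ici R)

/-- The function `t ↦ e^{zt} / (sinh(πt) sinh(γt) t)`. -/
def integrand (γ z t : ℂ) : ℂ :=
  Complex.exp (z * t) / (Complex.sinh ((π : ℂ) * t) * Complex.sinh (γ * t) * t)

/-- The radii `R` that are allowed in the contour `C_R`. -/
def AdmissibleRadius (γ : ℂ) (R : ℝ) : Prop := 0 < R ∧ R < min (π / ‖γ‖) 1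

/-- The quantum dilogarithm `S_γ(z)`, computed with the contour `C_R`. -/
def S (R : ℝ) (γ z : ℂ) : ℂ := Complex.exp (1 / 4 * contourIntegral R (integrand γ z))

/-- `z` is in the open strip `|Re z| < π + Re γ` where `S_γ` is defined, and the integral that
defines `S_γ(z)` converges absolutely. -/
def DefinedAt (R : ℝ) (γ z : ℂ) : Prop :=
  |z.re| < π + γ.re ∧ ContourIntegrable R (integrand γ z)

/-- `ξ = 2πi + u`. -/
def xi (u : ℝ) : ℂ := 2 * (π : ℂ) * Complex.I + (u : ℂ)

/-- `γ = (2π - iu) / (2(N + n - 2))`. -/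
def gam (u : ℝ) (n N : ℕ) : ℂ :=
  (2 * (π : ℂ) - Complex.I * (u : ℂ)) / (2 * ((N : ℂ) + (n : ℂ) - 2))

/-- The argument `-π - iu + γ` of the numerator. -/
def numArg (u : ℝ) (n N : ℕ) : ℂ := -(π : ℂ) - Complex.I * (u : ℂ) + gam u n N

/-- The argument `π - iu - (2n - 3)γ` of the denominator. -/
def denArg (u : ℝ) (n N : ℕ) : ℂ :=
  (π : ℂ) - Complex.I * (u : ℂ) - (2 * (n : ℂ) - 3) * gam u n N

end

end QDilog

open scoped Topology

namespace QDilog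

/-! The quotient is computed from the two functional equations `S(z - γ) = (1 + e^{iz}) S(z + γ)`
for `|Re z| < π`, and `S(z - π) = (1 + e^{πiz/γ}) S(z + π)` for `|Re z| < Re γ`. With `v = -iu`, the
second, taken at `v + γ`, leads from the numerator's argument to `π + v + γ`. The first, used `n -
1` times, leads from there to the denominator's argument. The linking point lies on the boundary of
the strip, so the identities are used at points shifted left by `ε`, and then `ε → 0⁺`
(`lineS_quotient`). The factors `1 + e^{...}` turn into `-(e^{...} - 1)`, and the signs cancel
because `n` is even.

Both equations have one source. Since `e^{(z+d)t} - e^{(z-d)t} = 2 e^{zt} sinh(dt)`, a shift by `±d`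
cancels one `sinh` and leaves `L(z) = ∫ e^{zt} / (t sinh(ct)) dt` (`lineIntegral_shift`), where `{c,
d} = {π, γ}`. The closed form `e^{L/2} = 1 / (1 + e^{zp})`, `p = πi/c`, is `exp_logKernel`: `L'` has
no factor `1/t`, so translating its line by `p` and collecting one residue evaluates it
(`line_integral_exp_div_sinh`). Hence `(1 + e^{zp}) e^{L/2}` is constant, and its limit far up the
imaginary axis is `1`.

All of this is done on a line `Im t = h` with small `h > 0`, where there is no semicircle to handle.
`S_eq_lineS` identifies the contour integral with the line integral, which also removes the
dependence on the radius.

For the asymptotics, `γ → 0` sends the product to `(e^u - 1)^{n-1}`, while `uπ/γ` is exactly the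
exponent in the claim and its real part tends to infinity, so the `-1` in the numerator is
negligible. -/

/-! ### Exponential decay of the factors of the integrand -/

lemma exp_abs_le_norm_sinh {w : ℂ} (hw : 1 ≤ |w.re|) :
    Real.exp |w.re| / 4 ≤ ‖Complex.sinh w‖ := by
  have key : (Real.exp |w.re| - Real.exp (-|w.re|)) / 2 ≤ ‖Complex.sinh w‖ := by
    rw [Complex.sinh, norm_div, Complex.norm_ofNat]
    gcongr
    rcases abs_cases w.re with ⟨h, -⟩ | ⟨h, -⟩ <;> rw [h]
    · have := norm_sub_norm_le (Complex.exp w) (Complex.exp (-w))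
      simpa [Complex.norm_exp] using this
    · have := norm_sub_norm_le (Complex.exp (-w)) (Complex.exp w)
      rw [norm_sub_rev] at this
      simpa [Complex.norm_exp] using this
  have h1 : Real.exp (-|w.re|) ≤ 1 := Real.exp_le_one_iff.2 (by linarith)
  have h2 : |w.re| + 1 ≤ Real.exp |w.re| := Real.add_one_le_exp _
  linarith

lemma sinh_mul_eq_zero_iff {c : ℂ} (hc : c ≠ 0) (t : ℂ) :
    Complex.sinh (c * t) = 0 ↔ ∃ k : ℤ, t = k * (π * Complex.I / c) := by
  have h1 : Complex.sinh (c * t) = 0 ↔ Complex.sin (c * t * Complex.I) = 0 := by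
    rw [Complex.sin_mul_I]; simp
  rw [h1, Complex.sin_eq_zero_iff]
  constructor
  · rintro ⟨k, hk⟩
    refine ⟨-k, ?_⟩
    have : c * t = -(k * π * Complex.I) := by
      linear_combination (-Complex.I) * hk + (c * t) * Complex.I_sq
    push_cast
    field_simp
    linear_combination this
  · rintro ⟨k, rfl⟩
    refine ⟨-k, ?_⟩
    push_cast
    field_simp
    linear_combination (k : ℂ) * Complex.I_sq

/-- `f` is bounded by a multiple of `e^{-δ |Re t|}` on `F`. -/
def ExpDecay (δ : ℝ) (f : ℂ → ℂ) (F : Set ℂ) : Prop :=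
  ∃ M : ℝ, 0 ≤ M ∧ ∀ t ∈ F, ‖f t‖ ≤ M * Real.exp (-δ * |t.re|)

lemma ExpDecay.mul {δ ε : ℝ} {f g : ℂ → ℂ} {F : Set ℂ} (hf : ExpDecay δ f F)
    (hg : ExpDecay ε g F) : ExpDecay (δ + ε) (fun t => f t * g t) F := by
  obtain ⟨M, hM, hf⟩ := hf
  obtain ⟨N, hN, hg⟩ := hg
  refine ⟨M * N, mul_nonneg hM hN, fun t ht => ?_⟩
  rw [norm_mul]
  calc ‖f t‖ * ‖g t‖ ≤ (M * Real.exp (-δ * |t.re|)) * (N * Real.exp (-ε * |t.re|)) :=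
        mul_le_mul (hf t ht) (hg t ht) (norm_nonneg _) (by positivity)
    _ = M * N * Real.exp (-(δ + ε) * |t.re|) := by
        rw [show -(δ + ε) * |t.re| = -δ * |t.re| + -ε * |t.re| by ring, Real.exp_add]; ring

/-- Far out, `|sinh(ct)|` grows like `e^{|Re(ct)|}`, and `Re(ct)` differs from `Re c · Re t` by a
bounded amount. The rest of `F` is compact, so a nonvanishing continuous function is bounded below
there. -/
lemma expDecay_inv_sinh {c : ℂ} (hc : 0 < c.re) {F : Set ℂ} (hF : IsClosed F) {B : ℝ}
    (hB : ∀ t ∈ F, |t.im| ≤ B) (h0 : ∀ t ∈ F, Complex.sinh (c * t) ≠ 0) :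
    ExpDecay c.re (fun t => (Complex.sinh (c * t))⁻¹) F := by
  -- Beyond this abscissa `|Re(ct)| ≥ 1`, as the lower bound for `sinh` requires.
  set X : ℝ := (1 + |c.im| * B) / c.re with hX
  have hK : IsCompact (F ∩ (Set.Icc (-X) X ×ℂ Set.Icc (-B) B)) :=
    (isCompact_Icc.reProdIm isCompact_Icc).inter_left hF
  obtain ⟨m, hm, hmin⟩ := hK.exists_forall_le' (f := fun t : ℂ =>
      ‖Complex.sinh (c * t)‖ * Real.exp (-c.re * |t.re|)) (a := 0) (by fun_prop)
      (fun t ht => mul_pos (norm_pos_iff.2 (h0 t ht.1)) (Real.exp_pos _))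
  have hfar : ∀ t ∈ F, X < |t.re| →
      Real.exp (-(|c.im| * B)) / 4 ≤ ‖Complex.sinh (c * t)‖ * Real.exp (-c.re * |t.re|) := by
    intro t ht hXt
    have h1 : c.re * |t.re| - |c.im| * B ≤ |(c * t).re| := by
      rw [Complex.mul_re]
      have h2 := abs_sub_abs_le_abs_sub (c.re * t.re) (c.im * t.im)
      rw [abs_mul, abs_mul, abs_of_pos hc] at h2
      have := mul_le_mul_of_nonneg_left (hB t ht) (abs_nonneg c.im)
      linarith
    have h3 : 1 + |c.im| * B < c.re * |t.re| := by
      rw [hX, div_lt_iff₀ hc] at hXt; linarith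
    have h4 := exp_abs_le_norm_sinh (w := c * t) (by linarith)
    have h5 := Real.exp_le_exp.2 h1
    calc Real.exp (-(|c.im| * B)) / 4
        = Real.exp (c.re * |t.re| - |c.im| * B) / 4 * Real.exp (-c.re * |t.re|) := by
          rw [div_mul_eq_mul_div, ← Real.exp_add]; congr 2; ring
      _ ≤ _ := by
          gcongr
          linarith
  set m' := min m (Real.exp (-(|c.im| * B)) / 4) with hm'
  have hm'0 : 0 < m' := lt_min hm (by positivity)
  refine ⟨m'⁻¹, by positivity, fun t ht => ?_⟩
  have key : m' ≤ ‖Complex.sinh (c * t)‖ * Real.exp (-c.re * |t.re|) := by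
    by_cases hXt : X < |t.re|
    · exact (min_le_right _ _).trans (hfar t ht hXt)
    · exact (min_le_left _ _).trans
        (hmin t ⟨ht, abs_le.1 (not_lt.1 hXt), abs_le.1 (hB t ht)⟩)
  have hs : 0 < ‖Complex.sinh (c * t)‖ := norm_pos_iff.2 (h0 t ht)
  rw [norm_inv, inv_mul_eq_div, le_div_iff₀ hm'0, inv_mul_le_iff₀ hs]
  exact key

lemma expDecay_exp (z : ℂ) {F : Set ℂ} {B : ℝ} (hB : ∀ t ∈ F, |t.im| ≤ B) :
    ExpDecay (-|z.re|) (fun t => Complex.exp (z * t)) F := by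
  refine ⟨Real.exp (|z.im| * B), (Real.exp_pos _).le, fun t ht => ?_⟩
  rw [Complex.norm_exp, ← Real.exp_add, Complex.mul_re, neg_neg, ← abs_mul]
  apply Real.exp_le_exp.2
  have h1 := le_abs_self (z.re * t.re)
  have h2 := neg_abs_le (z.im * t.im)
  rw [abs_mul] at h2
  have := mul_le_mul_of_nonneg_left (hB t ht) (abs_nonneg z.im)
  linarith

lemma expDecay_inv {F : Set ℂ} {r : ℝ} (hr : 0 < r) (h : ∀ t ∈ F, r ≤ ‖t‖) :
    ExpDecay 0 (fun t => t⁻¹) F := by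
  refine ⟨r⁻¹, by positivity, fun t ht => ?_⟩
  rw [norm_inv, neg_zero, zero_mul, Real.exp_zero, mul_one]
  exact inv_anti₀ hr (h t ht)

lemma integrable_exp_neg_mul_abs {δ : ℝ} (hδ : 0 < δ) :
    Integrable fun x : ℝ => Real.exp (-δ * |x|) := by
  rw [← integrableOn_univ, ← Set.Iic_union_Ioi (a := (0 : ℝ))]
  refine IntegrableOn.union ?_ ?_
  · refine (integrableOn_exp_mul_Iic hδ 0).congr_fun (fun x hx => ?_) measurableSet_Iic
    simp only [abs_of_nonpos (Set.mem_Iic.1 hx)]; ring_nf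
  · refine (integrableOn_exp_mul_Ioi (a := -δ) (by linarith) 0).congr_fun (fun x hx => ?_)
      measurableSet_Ioi
    simp only [abs_of_pos (Set.mem_Ioi.1 hx)]

lemma ExpDecay.integrableOn {δ : ℝ} (hδ : 0 < δ) {f : ℂ → ℂ} {F : Set ℂ} (h : ExpDecay δ f F)
    {s : Set ℝ} (hs : MeasurableSet s) {b : ℝ}
    (hsF : ∀ x ∈ s, (x + b * Complex.I : ℂ) ∈ F) (hf : ContinuousOn f F) :
    IntegrableOn (fun x : ℝ => f (x + b * Complex.I)) s := by
  obtain ⟨M, hM, h⟩ := h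
  refine Integrable.mono' (((integrable_exp_neg_mul_abs hδ).const_mul M).integrableOn) ?_ ?_
  · refine ContinuousOn.aestronglyMeasurable ?_ hs
    exact hf.comp (by fun_prop) hsF
  · refine (ae_restrict_iff' hs).2 (Eventually.of_forall fun x hx => ?_)
    simpa using h _ (hsF x hx)

/-! ### Cauchy's theorem in rectangles and horizontal strips -/

/-- `|Re t| → ∞` in the horizontal strip `a ≤ Im t ≤ b`. -/
def stripEnds (a b : ℝ) : Filter ℂ :=
  comap (fun t : ℂ => |t.re|) atTop ⊓ 𝓟 {t | t.im ∈ Set.Icc a b}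

lemma ExpDecay.tendsto {δ : ℝ} (hδ : 0 < δ) {f : ℂ → ℂ} {F : Set ℂ} (h : ExpDecay δ f F)
    {a b : ℝ} (hF : F ∈ stripEnds a b) : Tendsto f (stripEnds a b) (𝓝 0) := by
  obtain ⟨M, hM, h⟩ := h
  have h1 : Tendsto (fun t : ℂ => M * Real.exp (-δ * |t.re|)) (stripEnds a b) (𝓝 (M * 0)) := by
    refine Tendsto.const_mul M (Real.tendsto_exp_atBot.comp ?_)
    exact (tendsto_comap.mono_left inf_le_left).const_mul_atTop_of_neg (by linarith)
  rw [mul_zero] at h1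
  refine squeeze_zero_norm' ?_ h1
  filter_upwards [hF] with t ht using h t ht

lemma mem_stripEnds_of {a b : ℝ} {F : Set ℂ} (T : ℝ)
    (h : ∀ t : ℂ, T ≤ |t.re| → t.im ∈ Set.Icc a b → t ∈ F) : F ∈ stripEnds a b := by
  refine mem_inf_of_inter (preimage_mem_comap (Ici_mem_atTop T)) (mem_principal_self _) ?_
  rintro t ⟨h1, h2⟩
  exact h t h1 h2

lemma tendsto_inv_sub_stripEnds (p : ℂ) (a b : ℝ) :
    Tendsto (fun t : ℂ => (t - p)⁻¹) (stripEnds a b) (𝓝 0) := by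
  refine tendsto_inv₀_cobounded.comp ?_
  rw [← tendsto_norm_atTop_iff_cobounded]
  have h1 : Tendsto (fun t : ℂ => |t.re| - |p.re|) (stripEnds a b) atTop :=
    tendsto_atTop_add_const_right _ _ (tendsto_comap.mono_left inf_le_left)
  refine tendsto_atTop_mono (fun t => ?_) h1
  calc |t.re| - |p.re| ≤ |t.re - p.re| := abs_sub_abs_le_abs_sub _ _
    _ = |(t - p).re| := by simp
    _ ≤ _ := Complex.abs_re_le_norm _

lemma tendsto_integral_vertical {f : ℂ → ℂ} {a b : ℝ} (hab : a ≤ b)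
    (hf : Tendsto f (stripEnds a b) (𝓝 0)) {l : Filter ℝ}
    (hl : Tendsto (fun x : ℝ => |x|) l atTop) :
    Tendsto (fun x : ℝ => ∫ y : ℝ in a..b, f (x + y * Complex.I)) l (𝓝 0) := by
  rw [Metric.tendsto_nhds]
  intro ε hε
  have hε' : 0 < ε / (b - a + 1) := div_pos hε (by linarith)
  have h1 := hf (Metric.closedBall_mem_nhds 0 hε')
  obtain ⟨u, hu, v, hv, huv⟩ := mem_inf_iff_superset.1 (mem_map.1 h1)
  obtain ⟨s, hs, hsu⟩ := hu
  filter_upwards [hl hs] with x hx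
  rw [dist_zero_right]
  have h2 : ∀ y ∈ Set.uIoc a b, ‖f (x + y * Complex.I)‖ ≤ ε / (b - a + 1) := by
    intro y hy
    rw [Set.uIoc_of_le hab] at hy
    have : (x + y * Complex.I : ℂ) ∈ u ∩ v := by
      refine ⟨hsu (by simpa using hx), hv ?_⟩
      simpa using ⟨hy.1.le, hy.2⟩
    simpa using huv this
  calc _ ≤ ε / (b - a + 1) * |b - a| := intervalIntegral.norm_integral_le_of_norm_le_const h2
    _ < ε := by
      rw [abs_of_nonneg (by linarith), div_mul_eq_mul_div, div_lt_iff₀ (by linarith)]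
      nlinarith

lemma rectangle_integral_eq {f : ℂ → ℂ} {x₁ x₂ a b : ℝ} (hx : x₁ ≤ x₂) (hab : a ≤ b)
    {s : Set ℂ} (hs : s.Countable)
    (hc : ∀ t : ℂ, t.re ∈ Set.Icc x₁ x₂ → t.im ∈ Set.Icc a b → ContinuousAt f t)
    (hd : ∀ t : ℂ, t.re ∈ Set.Icc x₁ x₂ → t.im ∈ Set.Icc a b → t ∉ s → DifferentiableAt ℂ f t) :
    (∫ x in x₁..x₂, f (x + a * Complex.I)) - (∫ x in x₁..x₂, f (x + b * Complex.I)) =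
      Complex.I * (∫ y in a..b, f (x₁ + y * Complex.I)) -
      Complex.I * (∫ y in a..b, f (x₂ + y * Complex.I)) := by
  have := Complex.integral_boundary_rect_eq_zero_of_differentiable_on_off_countable f
    (⟨x₁, a⟩ : ℂ) ⟨x₂, b⟩ s hs ?_ ?_
  · simp only [smul_eq_mul] at this
    linear_combination this
  · intro t ht
    simp only [Set.uIcc_of_le hx, Set.uIcc_of_le hab] at ht
    exact (hc t ht.1 ht.2).continuousWithinAt
  · intro t ht
    simp only [min_eq_left hx, max_eq_right hx, min_eq_left hab, max_eq_right hab] at ht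
    exact hd t (Set.Ioo_subset_Icc_self ht.1.1) (Set.Ioo_subset_Icc_self ht.1.2) ht.2

/-- Let the vertical sides of a rectangle go to infinity. Only the difference of the two boundary
functions is assumed integrable, because a term `1 / (t - p)` is not absolutely integrable along a
single line. The countable set allows for a removed singularity. -/
lemma strip_integral_sub_eq_zero {f : ℂ → ℂ} {a b : ℝ} (hab : a ≤ b)
    {s : Set ℂ} (hs : s.Countable)
    (hc : ∀ t : ℂ, t.im ∈ Set.Icc a b → ContinuousAt f t)
    (hd : ∀ t : ℂ, t.im ∈ Set.Icc a b → t ∉ s → DifferentiableAt ℂ f t)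
    (hlim : Tendsto f (stripEnds a b) (𝓝 0))
    (hint : Integrable fun x : ℝ => f (x + a * Complex.I) - f (x + b * Complex.I)) :
    ∫ x : ℝ, (f (x + a * Complex.I) - f (x + b * Complex.I)) = 0 := by
  have h1 := intervalIntegral_tendsto_integral hint tendsto_neg_atTop_atBot tendsto_id
  refine tendsto_nhds_unique h1 ?_
  have h2 := ((tendsto_integral_vertical hab hlim (l := atBot) tendsto_abs_atBot_atTop).comp
    tendsto_neg_atTop_atBot).const_mul Complex.I
  have h3 := (tendsto_integral_vertical hab hlim (l := atTop) tendsto_abs_atTop_atTop).const_mul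
    Complex.I
  have h4 := h2.sub h3
  simp only [mul_zero, sub_zero] at h4
  refine h4.congr' ?_
  filter_upwards [eventually_ge_atTop 0] with T hT
  have hline : ∀ y ∈ Set.Icc a b, Continuous fun x : ℝ => f (x + y * Complex.I) := by
    intro y hy
    refine continuous_iff_continuousAt.2 fun x => ?_
    exact ContinuousAt.comp (f := fun x : ℝ => (x + y * Complex.I : ℂ)) (hc _ (by simpa using hy))
      (by fun_prop)
  rw [intervalIntegral.integral_sub
    ((hline a (Set.left_mem_Icc.2 hab)).intervalIntegrable _ _)
    ((hline b (Set.right_mem_Icc.2 hab)).intervalIntegrable _ _)]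
  exact (rectangle_integral_eq (show -T ≤ T by linarith) hab hs (fun t _ => hc t)
    (fun t _ => hd t)).symm

/-! ### From the indented contour to a horizontal line -/

/-- Under `t = e^w` the punctured disc becomes the convex half-plane `Re w < log ρ`, where a
primitive of `f(e^w) e^w` exists. A logarithm cut along the negative imaginary axis carries it back,
so the closed upper half-plane minus `0` is covered, including both real half-axes. -/
lemma exists_primitive_upper {f : ℂ → ℂ} {ρ : ℝ} (hρ : 0 < ρ)
    (hf : ∀ t : ℂ, t ≠ 0 → ‖t‖ < ρ → DifferentiableAt ℂ f t) :
    ∃ F : ℂ → ℂ, ∀ t : ℂ, 0 ≤ t.im → t ≠ 0 → ‖t‖ < ρ → HasDerivAt F (f t) t := by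
  have hopen : IsOpen {w : ℂ | w.re < Real.log ρ} :=
    isOpen_lt Complex.continuous_re continuous_const
  obtain ⟨G, hG⟩ := (convex_halfSpace_re_lt (Real.log ρ)).exists_forall_hasDerivWithinAt (𝕜 := ℂ)
    (f := fun w => f (Complex.exp w) * Complex.exp w) (fun w hw => by
      have hw' : ‖Complex.exp w‖ < ρ := by
        rw [Complex.norm_exp]; exact (Real.lt_log_iff_exp_lt hρ).1 hw
      exact (((hf _ (Complex.exp_ne_zero w) hw').comp w
        Complex.differentiableAt_exp).mul Complex.differentiableAt_exp).differentiableWithinAt)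
  refine ⟨fun t => G (Complex.log (-Complex.I * t) + Complex.I * (π / 2)), fun t him h0 hn => ?_⟩
  have hslit : -Complex.I * t ∈ Complex.slitPlane := by
    rw [Complex.mem_slitPlane_iff]
    by_cases h : t.re = 0
    · left
      have : t.im ≠ 0 := fun h' => h0 (Complex.ext h h')
      simpa using lt_of_le_of_ne him this.symm
    · right
      simpa using h
  set w := Complex.log (-Complex.I * t) + Complex.I * (π / 2) with hw
  have hexp : Complex.exp w = t := by
    rw [hw, Complex.exp_add, Complex.exp_log (Complex.slitPlane_ne_zero hslit),
      mul_comm Complex.I, Complex.exp_pi_div_two_mul_I]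
    linear_combination (-t) * Complex.I_sq
  have hwmem : w ∈ {w : ℂ | w.re < Real.log ρ} := by
    rw [Set.mem_ofPred_eq, Real.lt_log_iff_exp_lt hρ, ← Complex.norm_exp, hexp]
    exact hn
  have h1 := (hG w hwmem).hasDerivAt (hopen.mem_nhds hwmem)
  have h2 : HasDerivAt (fun t : ℂ => Complex.log (-Complex.I * t) + Complex.I * (π / 2))
      (-Complex.I / (-Complex.I * t)) t := by
    have := ((hasDerivAt_id t).const_mul (-Complex.I)).clog hslit
    simpa using this.add_const (Complex.I * (π / 2))
  have h3 := h1.comp t h2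
  refine h3.congr_deriv ?_
  rw [hexp]
  have := Complex.I_ne_zero
  field_simp

lemma norm_arc {R : ℝ} (hR : 0 < R) (s : ℝ) : ‖arc R s‖ = R := by
  rw [arc, norm_mul, Complex.norm_real, Real.norm_of_nonneg hR.le, mul_comm Complex.I,
    ← Complex.ofReal_sub, Complex.norm_exp_ofReal_mul_I, mul_one]

lemma arc_im (R s : ℝ) : (arc R s).im = R * Real.sin s := by
  rw [arc, mul_comm Complex.I, ← Complex.ofReal_sub, Complex.im_ofReal_mul,
    Complex.exp_ofReal_mul_I_im, Real.sin_pi_sub]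

lemma hasDerivAt_arc (R s : ℝ) : HasDerivAt (arc R) (-Complex.I * arc R s) s := by
  have h : HasDerivAt (fun s : ℝ => Complex.I * ((π : ℂ) - (s : ℂ))) (Complex.I * (-1)) s :=
    ((Complex.ofRealCLM.hasDerivAt (x := s)).const_sub (π : ℂ)).const_mul Complex.I
  exact (h.cexp.const_mul (R : ℂ)).congr_deriv (by rw [arc]; ring)

lemma continuous_arc (R : ℝ) : Continuous (arc R) :=
  continuous_iff_continuousAt.2 fun s => (hasDerivAt_arc R s).continuousAt

lemma arc_zero (R : ℝ) : arc R 0 = -R := by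
  rw [arc, Complex.ofReal_zero, sub_zero, mul_comm Complex.I, Complex.exp_pi_mul_I]; ring

lemma arc_pi (R : ℝ) : arc R π = R := by
  rw [arc]; simp

lemma continuous_arcIntegrand {f : ℂ → ℂ} {R ρ : ℝ} (hR : 0 < R) (hRρ : R < ρ)
    (hf : ∀ t : ℂ, t ≠ 0 → ‖t‖ < ρ → DifferentiableAt ℂ f t) :
    Continuous (arcIntegrand R f) := by
  refine Continuous.mul (continuous_iff_continuousAt.2 fun s => ?_)
    (continuous_const.mul (continuous_arc R))
  have hn := norm_arc hR s
  exact ContinuousAt.comp (f := arc R)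
    (hf _ (norm_pos_iff.1 (by rw [hn]; exact hR)) (by rw [hn]; exact hRρ)).continuousAt
    (continuous_arc R).continuousAt

/-- The semicircle and the path over the other three sides of the rectangle on `[-R, R]` have the
same endpoints and lie where one primitive serves both. The condition on `R² + h²` keeps the corners
inside the disc. -/
lemma arc_integral_eq {f : ℂ → ℂ} {R h ρ : ℝ} (hR : 0 < R) (hh : 0 < h) (hρ : 0 < ρ)
    (hRh : R ^ 2 + h ^ 2 < ρ ^ 2)
    (hf : ∀ t : ℂ, t ≠ 0 → ‖t‖ < ρ → DifferentiableAt ℂ f t) :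
    (∫ s in (0 : ℝ)..π, arcIntegrand R f s) =
      (∫ x in (-R)..R, f (x + h * Complex.I)) +
        Complex.I * (∫ y in (0 : ℝ)..h, f ((-R : ℝ) + y * Complex.I)) -
        Complex.I * (∫ y in (0 : ℝ)..h, f (R + y * Complex.I)) := by
  obtain ⟨F, hF⟩ := exists_primitive_upper hρ hf
  have hRρ : R < ρ := lt_of_pow_lt_pow_left₀ 2 hρ.le (by nlinarith)
  have hnorm : ∀ x y : ℝ, x ^ 2 ≤ R ^ 2 → 0 ≤ y → y ≤ h → ‖(x + y * Complex.I : ℂ)‖ < ρ := by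
    intro x y hx hy hyh
    refine lt_of_pow_lt_pow_left₀ 2 hρ.le ?_
    rw [← Complex.normSq_eq_norm_sq, Complex.normSq_add_mul_I]
    nlinarith
  have hpt : ∀ x y : ℝ, x ^ 2 ≤ R ^ 2 → 0 ≤ y → y ≤ h → (x ≠ 0 ∨ y ≠ 0) →
      HasDerivAt F (f (x + y * Complex.I)) (x + y * Complex.I) ∧
        ContinuousAt f (x + y * Complex.I) := by
    intro x y hx hy hyh hne
    have h0 : (x + y * Complex.I : ℂ) ≠ 0 := by
      intro h'
      have h1 := congrArg Complex.re h'
      have h2 := congrArg Complex.im h'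
      simp at h1 h2
      tauto
    exact ⟨hF _ (by simpa using hy) h0 (hnorm x y hx hy hyh),
      (hf _ h0 (hnorm x y hx hy hyh)).continuousAt⟩
  have harc : (∫ s in (0 : ℝ)..π, arcIntegrand R f s) = F R - F (-R) := by
    rw [← arc_zero, ← arc_pi R]
    refine intervalIntegral.integral_eq_sub_of_hasDerivAt (f := fun s => F (arc R s))
      (fun s hs => ?_) ((continuous_arcIntegrand hR hRρ hf).intervalIntegrable _ _)
    rw [Set.uIcc_of_le Real.pi_pos.le] at hs
    have hn := norm_arc hR s
    refine (hF (arc R s) ?_ (norm_pos_iff.1 (by rw [hn]; exact hR))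
      (by rw [hn]; exact hRρ)).comp s (hasDerivAt_arc R s)
    rw [arc_im]
    exact mul_nonneg hR.le (Real.sin_nonneg_of_mem_Icc hs)
  have hhor : (∫ x in (-R)..R, f (x + h * Complex.I)) =
      F (R + h * Complex.I) - F ((-R : ℝ) + h * Complex.I) := by
    have hx2 : ∀ x ∈ Set.uIcc (-R) R, x ^ 2 ≤ R ^ 2 := by
      intro x hx
      rw [Set.uIcc_of_le (by linarith)] at hx
      nlinarith [hx.1, hx.2]
    refine intervalIntegral.integral_eq_sub_of_hasDerivAt
      (f := fun x : ℝ => F (x + h * Complex.I)) (fun x hx => ?_) ?_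
    · have h1 := (hpt x h (hx2 x hx) hh.le le_rfl (Or.inr hh.ne')).1
      have h2 : HasDerivAt (fun x : ℝ => (x + h * Complex.I : ℂ)) 1 x :=
        (Complex.ofRealCLM.hasDerivAt (x := x)).add_const _
      exact (h1.comp x h2).congr_deriv (by simp)
    · refine ContinuousOn.intervalIntegrable fun x hx => ?_
      exact (ContinuousAt.comp (f := fun x : ℝ => (x + h * Complex.I : ℂ))
        (hpt x h (hx2 x hx) hh.le le_rfl (Or.inr hh.ne')).2 (by fun_prop)).continuousWithinAt
  have hver : ∀ x : ℝ, x ^ 2 = R ^ 2 → Complex.I * (∫ y in (0 : ℝ)..h, f (x + y * Complex.I)) =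
      F (x + h * Complex.I) - F x := by
    intro x hx
    have hx0 : x ≠ 0 := by rintro rfl; nlinarith
    rw [← intervalIntegral.integral_const_mul]
    have := intervalIntegral.integral_eq_sub_of_hasDerivAt (a := 0) (b := h)
      (f := fun y : ℝ => F (x + y * Complex.I))
      (f' := fun y : ℝ => Complex.I * f (x + y * Complex.I)) (fun y hy => ?_) ?_
    · simpa using this
    · rw [Set.uIcc_of_le hh.le] at hy
      have h1 := (hpt x y hx.le hy.1 hy.2 (Or.inl hx0)).1
      have h2 : HasDerivAt (fun y : ℝ => (x + y * Complex.I : ℂ)) Complex.I y := by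
        simpa using ((Complex.ofRealCLM.hasDerivAt (x := y)).mul_const Complex.I).const_add (x : ℂ)
      exact (h1.comp y h2).congr_deriv (by ring)
    · refine ContinuousOn.intervalIntegrable fun y hy => ?_
      rw [Set.uIcc_of_le hh.le] at hy
      exact (continuousAt_const.mul (ContinuousAt.comp (f := fun y : ℝ => (x + y * Complex.I : ℂ))
        (hpt x y hx.le hy.1 hy.2 (Or.inl hx0)).2 (by fun_prop))).continuousWithinAt
  rw [harc, hhor, hver (-R) (by ring), hver R rfl]
  push_cast
  ring

lemma contourIntegral_eq_line {f : ℂ → ℂ} {R h ρ : ℝ} (hR : 0 < R) (hh : 0 < h) (hρ : 0 < ρ)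
    (hRh : R ^ 2 + h ^ 2 < ρ ^ 2)
    (hball : ∀ t : ℂ, t ≠ 0 → ‖t‖ < ρ → DifferentiableAt ℂ f t)
    (hstrip : ∀ t : ℂ, t ≠ 0 → t.im ∈ Set.Icc 0 h → DifferentiableAt ℂ f t)
    (hlim : Tendsto f (stripEnds 0 h) (𝓝 0))
    (hleft : IntegrableOn (fun t : ℝ => f t) (Set.Iic (-R)))
    (hright : IntegrableOn (fun t : ℝ => f t) (Set.Ici R))
    (hline : Integrable fun x : ℝ => f (x + h * Complex.I)) :
    contourIntegral R f = ∫ x : ℝ, f (x + h * Complex.I) := by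
  rw [contourIntegral, integral_Ici_eq_integral_Ioi]
  have l1 := intervalIntegral_tendsto_integral_Iic (-R) hleft tendsto_neg_atTop_atBot
  have l2 := intervalIntegral_tendsto_integral_Ioi R (hright.mono_set Set.Ioi_subset_Ici_self)
    tendsto_id
  have l3 := intervalIntegral_tendsto_integral hline tendsto_neg_atTop_atBot tendsto_id
  have v1 := ((tendsto_integral_vertical hh.le hlim (l := atBot) tendsto_abs_atBot_atTop).comp
    tendsto_neg_atTop_atBot).const_mul Complex.I
  have v2 := (tendsto_integral_vertical hh.le hlim (l := atTop) tendsto_abs_atTop_atTop).const_mul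
    Complex.I
  have lhs := (l1.add_const (∫ s in (0 : ℝ)..π, arcIntegrand R f s)).add l2
  have rhs := (l3.add v1).sub v2
  simp only [mul_zero, sub_zero, add_zero] at rhs
  refine tendsto_nhds_unique lhs (rhs.congr' ?_)
  filter_upwards [eventually_ge_atTop R] with T hT
  have hint : ∀ a b : ℝ, IntervalIntegrable (fun x : ℝ => f (x + h * Complex.I)) volume a b :=
    fun a b => hline.intervalIntegrable
  have rect : ∀ x₁ x₂ : ℝ, x₁ ≤ x₂ → (∀ x ∈ Set.Icc x₁ x₂, x ≠ 0) →
      (∫ x in x₁..x₂, f x) - (∫ x in x₁..x₂, f (x + h * Complex.I)) =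
      Complex.I * (∫ y in (0 : ℝ)..h, f (x₁ + y * Complex.I)) -
      Complex.I * (∫ y in (0 : ℝ)..h, f (x₂ + y * Complex.I)) := by
    intro x₁ x₂ hx h0
    have hd : ∀ t : ℂ, t.re ∈ Set.Icc x₁ x₂ → t.im ∈ Set.Icc 0 h → DifferentiableAt ℂ f t :=
      fun t hre him => hstrip t (by rintro rfl; exact h0 0 hre rfl) him
    have := rectangle_integral_eq hx hh.le Set.countable_empty
      (fun t a b => (hd t a b).continuousAt) (fun t a b _ => hd t a b)
    simpa using this
  -- The rectangles over `[-T, -R]` and `[R, T]` avoid the origin; their inner vertical sides cancel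
  -- those from the semicircle.
  have r1 := rect (-T) (-R) (by linarith) (fun x hx => by linarith [hx.2] |> ne_of_lt)
  have r2 := rect R T hT (fun x hx => (by linarith [hx.1] : (0 : ℝ) < x).ne')
  have ra := arc_integral_eq hR hh hρ hRh hball
  have s1 := intervalIntegral.integral_add_adjacent_intervals (hint (-T) (-R)) (hint (-R) R)
  have s2 := intervalIntegral.integral_add_adjacent_intervals (hint (-T) R) (hint R T)
  simp only [Function.comp, id]
  linear_combination -r1 - r2 - ra - s1 - s2

/-! ### Holomorphic dependence of line integrals on `z` -/

lemma integrable_line_exp_mul {a h : ℝ} {g : ℂ → ℂ} (hg : ExpDecay a g {t | t.im = h})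
    (hc : ContinuousOn g {t | t.im = h}) {z : ℂ} (hz : |z.re| < a) :
    Integrable fun x : ℝ => Complex.exp (z * (x + h * Complex.I)) * g (x + h * Complex.I) := by
  have h1 := (expDecay_exp z (F := {t : ℂ | t.im = h}) (B := |h|)
    (fun t ht => by rw [show t.im = h from ht])).mul hg
  have h2 : ContinuousOn (fun t => Complex.exp (z * t) * g t) {t | t.im = h} :=
    ContinuousOn.mul (by fun_prop) hc
  rw [← integrableOn_univ]
  exact h1.integrableOn (by linarith) MeasurableSet.univ (fun x _ => by simp) h2

lemma hasDerivAt_line_exp_mul {a h : ℝ} {g : ℂ → ℂ} (hg : ExpDecay a g {t | t.im = h})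
    (hc : ContinuousOn g {t | t.im = h}) {z : ℂ} (hz : |z.re| < a) :
    HasDerivAt
      (fun z : ℂ => ∫ x : ℝ, Complex.exp (z * (x + h * Complex.I)) * g (x + h * Complex.I))
      (∫ x : ℝ, (x + h * Complex.I) * Complex.exp (z * (x + h * Complex.I)) *
        g (x + h * Complex.I)) z := by
  obtain ⟨M, hM, hgM⟩ := id hg
  -- The spare decay `δ` is split: `δ/2` pays for varying `z` in a ball, `δ/4` absorbs the factor
  -- `t` produced by differentiation, and `δ/4` remains for integrability.
  set δ := a - |z.re| with hδ
  have hδ0 : 0 < δ := by linarith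
  have hgc : Continuous fun x : ℝ => g (x + h * Complex.I) :=
    hc.comp_continuous (by fun_prop) (fun x => by simp)
  set C : ℝ := (4 / δ + |h|) * Real.exp ((|z.im| + δ / 2) * |h|) * M with hC
  refine (hasDerivAt_integral_of_dominated_loc_of_deriv_le
    (F := fun (z : ℂ) (x : ℝ) => Complex.exp (z * (x + h * Complex.I)) * g (x + h * Complex.I))
    (F' := fun (z : ℂ) (x : ℝ) =>
      (x + h * Complex.I) * Complex.exp (z * (x + h * Complex.I)) * g (x + h * Complex.I))
    (bound := fun x => C * Real.exp (-(δ / 4) * |x|))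
    (Metric.ball_mem_nhds z (half_pos hδ0)) ?_ ?_ ?_ ?_ ?_ ?_).2
  · exact Eventually.of_forall fun w =>
      ((by fun_prop : Continuous fun x : ℝ =>
        Complex.exp (w * (x + h * Complex.I))).mul hgc).aestronglyMeasurable
  · exact integrable_line_exp_mul hg hc hz
  · exact ((by fun_prop : Continuous fun x : ℝ =>
        (x + h * Complex.I) * Complex.exp (z * (x + h * Complex.I))).mul hgc).aestronglyMeasurable
  · refine Eventually.of_forall fun x w hw => ?_
    have hwz : ‖w - z‖ < δ / 2 := by simpa [dist_eq_norm] using hw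
    have hre : |w.re| ≤ |z.re| + δ / 2 := by
      have h1 := Complex.abs_re_le_norm (w - z)
      have h2 := abs_sub_abs_le_abs_sub w.re z.re
      rw [Complex.sub_re] at h1
      linarith
    have him : |w.im| ≤ |z.im| + δ / 2 := by
      have h1 := Complex.abs_im_le_norm (w - z)
      have h2 := abs_sub_abs_le_abs_sub w.im z.im
      rw [Complex.sub_im] at h1
      linarith
    have e1 : ‖(x + h * Complex.I : ℂ)‖ ≤ (4 / δ + |h|) * Real.exp (δ / 4 * |x|) := by
      have n1 : ‖(x + h * Complex.I : ℂ)‖ ≤ |x| + |h| := by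
        refine (norm_add_le _ _).trans ?_
        simp
      have n2 := Real.add_one_le_exp (δ / 4 * |x|)
      have n3 : |x| ≤ 4 / δ * Real.exp (δ / 4 * |x|) := by
        calc |x| = 4 / δ * (δ / 4 * |x|) := by field_simp
          _ ≤ _ := by gcongr; linarith
      have n4 : 1 ≤ Real.exp (δ / 4 * |x|) := Real.one_le_exp (by positivity)
      nlinarith [abs_nonneg h]
    have e2 : ‖Complex.exp (w * (x + h * Complex.I))‖ ≤
        Real.exp ((|z.im| + δ / 2) * |h|) * Real.exp ((|z.re| + δ / 2) * |x|) := by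
      rw [Complex.norm_exp, ← Real.exp_add]
      apply Real.exp_le_exp.2
      have m1 : (w * (x + h * Complex.I)).re = w.re * x - w.im * h := by simp
      rw [m1]
      have m2 := le_abs_self (w.re * x)
      have m3 := neg_abs_le (w.im * h)
      rw [abs_mul] at m2 m3
      have m4 := mul_le_mul_of_nonneg_right hre (abs_nonneg x)
      have m5 := mul_le_mul_of_nonneg_right him (abs_nonneg h)
      linarith
    have e3 : ‖g (x + h * Complex.I)‖ ≤ M * Real.exp (-a * |x|) := by
      simpa using hgM (x + h * Complex.I) (by simp)
    rw [norm_mul, norm_mul]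
    calc _ ≤ ((4 / δ + |h|) * Real.exp (δ / 4 * |x|)) *
          (Real.exp ((|z.im| + δ / 2) * |h|) * Real.exp ((|z.re| + δ / 2) * |x|)) *
          (M * Real.exp (-a * |x|)) := by gcongr
      _ = C * (Real.exp (δ / 4 * |x|) * Real.exp ((|z.re| + δ / 2) * |x|) *
          Real.exp (-a * |x|)) := by rw [hC]; ring
      _ = C * Real.exp (-(δ / 4) * |x|) := by
        rw [← Real.exp_add, ← Real.exp_add, hδ]; congr 2; ring
  · exact (integrable_exp_neg_mul_abs (by positivity)).const_mul C
  · refine Eventually.of_forall fun x w _ => ?_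
    have h1 : HasDerivAt (fun w : ℂ => w * (x + h * Complex.I)) (1 * (x + h * Complex.I)) w :=
      (hasDerivAt_id w).mul_const _
    exact (h1.cexp.mul_const _).congr_deriv (by ring)

/-! ### Zeros of `sinh(ct)` -/

/-- The zero `πi/c` of `t ↦ sinh(ct)`. -/
noncomputable def pole (c : ℂ) : ℂ := π * Complex.I / c

lemma pole_im_pos {c : ℂ} (hc : 0 < c.re) : 0 < (pole c).im := by
  have hn : 0 < Complex.normSq c := Complex.normSq_pos.2 (by rintro rfl; simp at hc)
  have : (pole c).im = π * c.re / Complex.normSq c := by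
    rw [pole, Complex.div_im]; simp
  rw [this]
  have := Real.pi_pos
  positivity

lemma ne_zero_of_re_pos {c : ℂ} (hc : 0 < c.re) : c ≠ 0 := by rintro rfl; simp at hc

lemma mul_pole {c : ℂ} (hc : 0 < c.re) : c * pole c = π * Complex.I := by
  have := ne_zero_of_re_pos hc
  rw [pole]; field_simp

lemma sinh_mul_ne_zero_of_im {c : ℂ} (hc : 0 < c.re) {t : ℂ} (h0 : t ≠ 0) (h1 : 0 ≤ t.im)
    (h2 : t.im < (pole c).im) : Complex.sinh (c * t) ≠ 0 := by
  rw [Ne, sinh_mul_eq_zero_iff (ne_zero_of_re_pos hc)]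
  rintro ⟨k, hk⟩
  have hp := pole_im_pos hc
  have him : t.im = k * (pole c).im := by
    rw [hk, ← pole]; simp
  rw [him] at h1 h2
  have k1 : (k : ℝ) < 1 := by nlinarith
  have k0 : (-1 : ℝ) < k := by nlinarith
  have : k = 0 := by
    have a1 : k < 1 := by exact_mod_cast k1
    have a2 : -1 < k := by exact_mod_cast k0
    omega
  rw [this] at hk
  simp at hk
  exact h0 hk

lemma sinh_mul_ne_zero_of_norm {c : ℂ} (hc : 0 < c.re) {t : ℂ} (h0 : t ≠ 0)
    (h2 : ‖t‖ < π / ‖c‖) : Complex.sinh (c * t) ≠ 0 := by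
  rw [Ne, sinh_mul_eq_zero_iff (ne_zero_of_re_pos hc)]
  rintro ⟨k, hk⟩
  have hc0 : 0 < ‖c‖ := norm_pos_iff.2 (ne_zero_of_re_pos hc)
  have hk0 : k ≠ 0 := by rintro rfl; simp at hk; exact h0 hk
  have h1 : (1 : ℝ) ≤ |(k : ℝ)| := by exact_mod_cast Int.one_le_abs hk0
  have hn : ‖t‖ = |(k : ℝ)| * (π / ‖c‖) := by
    rw [hk]; simp [abs_of_pos Real.pi_pos]
  have : 0 < π / ‖c‖ := div_pos Real.pi_pos hc0
  rw [hn] at h2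
  nlinarith

lemma eq_pole_of_sinh_mul_eq_zero {c : ℂ} (hc : 0 < c.re) {t : ℂ} (h1 : 0 < t.im)
    (h2 : t.im < 2 * (pole c).im) (h : Complex.sinh (c * t) = 0) : t = pole c := by
  obtain ⟨k, hk⟩ := (sinh_mul_eq_zero_iff (ne_zero_of_re_pos hc) t).1 h
  have hp := pole_im_pos hc
  have him : t.im = k * (pole c).im := by
    rw [hk, ← pole]; simp
  rw [him] at h1 h2
  have k1 : (k : ℝ) < 2 := by nlinarith
  have k0 : (0 : ℝ) < k := by nlinarith
  have : k = 1 := by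
    have a1 : k < 2 := by exact_mod_cast k1
    have a2 : 0 < k := by exact_mod_cast k0
    omega
  rw [hk, this, pole]; simp

/-! ### The residue computation -/

lemma inv_sub_inv_conj {η : ℝ} (hη : 0 < η) (s : ℝ) :
    (s - η * Complex.I : ℂ)⁻¹ - (s + η * Complex.I : ℂ)⁻¹ =
      ((2 / η * (1 + (s / η) ^ 2)⁻¹ : ℝ) : ℂ) * Complex.I := by
  have h1 : (s - η * Complex.I : ℂ) ≠ 0 := by
    intro h; have := congrArg Complex.im h; simp at this; exact hη.ne' this
  have h2 : (s + η * Complex.I : ℂ) ≠ 0 := by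
    intro h; have := congrArg Complex.im h; simp at this; exact hη.ne' this
  have h3 : (η : ℂ) ≠ 0 := by exact_mod_cast hη.ne'
  have h4 : (s - η * Complex.I : ℂ) * (s + η * Complex.I) = s ^ 2 + η ^ 2 := by
    linear_combination (-(η : ℂ) ^ 2) * Complex.I_sq
  have h5 : (s ^ 2 + η ^ 2 : ℂ) ≠ 0 := h4 ▸ mul_ne_zero h1 h2
  have h6 : (1 + ((s : ℂ) / η) ^ 2) = (s ^ 2 + η ^ 2) / η ^ 2 := by field_simp; ring
  rw [inv_sub_inv h1 h2, h4]
  push_cast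
  rw [h6]
  field_simp
  ring

lemma integrable_inv_sub_inv_conj {η : ℝ} (hη : 0 < η) (q : ℝ) :
    Integrable fun x : ℝ =>
      (((x - q : ℝ) : ℂ) - η * Complex.I)⁻¹ - (((x - q : ℝ) : ℂ) + η * Complex.I)⁻¹ := by
  simp_rw [inv_sub_inv_conj hη]
  have := (((integrable_inv_one_add_sq.comp_div hη.ne').const_mul (2 / η)).comp_sub_right q)
  exact this.ofReal.mul_const _

lemma integral_inv_sub_inv_conj {η : ℝ} (hη : 0 < η) (q : ℝ) :
    ∫ x : ℝ, ((((x - q : ℝ) : ℂ) - η * Complex.I)⁻¹ - (((x - q : ℝ) : ℂ) + η * Complex.I)⁻¹) =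
      2 * π * Complex.I := by
  simp_rw [inv_sub_inv_conj hη]
  rw [integral_mul_const, integral_complex_ofReal,
    integral_sub_right_eq_self (fun x : ℝ => 2 / η * (1 + (x / η) ^ 2)⁻¹) q,
    integral_const_mul, Measure.integral_comp_div (fun x : ℝ => (1 + x ^ 2)⁻¹) η,
    integral_univ_inv_one_add_sq, smul_eq_mul, abs_of_pos hη]
  congr 1
  push_cast
  have h3 : (η : ℂ) ≠ 0 := by exact_mod_cast hη.ne'
  field_simp

/-- The midline `Im t = Im (πi/c) / 2` between the first two zeros of `sinh(ct)`. -/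
noncomputable def midHeight (c : ℂ) : ℝ := (pole c).im / 2

lemma midHeight_pos {c : ℂ} (hc : 0 < c.re) : 0 < midHeight c := half_pos (pole_im_pos hc)

lemma isClosed_im_eq (h : ℝ) : IsClosed {t : ℂ | t.im = h} :=
  isClosed_eq Complex.continuous_im continuous_const

lemma differentiableAt_exp_mul_inv_sinh {c z t : ℂ} (ht : Complex.sinh (c * t) ≠ 0) :
    DifferentiableAt ℂ (fun t => Complex.exp (z * t) * (Complex.sinh (c * t))⁻¹) t := by
  fun_prop (disch := assumption)

lemma expDecay_exp_mul_inv_sinh {c z : ℂ} (hc : 0 < c.re) {F : Set ℂ} (hF : IsClosed F) {B : ℝ}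
    (hB : ∀ t ∈ F, |t.im| ≤ B) (h0 : ∀ t ∈ F, Complex.sinh (c * t) ≠ 0) :
    ExpDecay (c.re - |z.re|) (fun t => Complex.exp (z * t) * (Complex.sinh (c * t))⁻¹) F := by
  have := (expDecay_exp z hB).mul (expDecay_inv_sinh hc hF hB h0)
  rwa [neg_add_eq_sub] at this

/-- Translation by `p = πi/c` changes the sign of `sinh(ct)` and multiplies `e^{zt}` by `e^{zp}`. So
the left side is the difference of the integrals over two lines on either side of `p`, that is `2πi`
times the residue `-e^{zp}/c`. -/
lemma line_integral_exp_div_sinh {c z : ℂ} (hc : 0 < c.re) (hz : |z.re| < c.re) :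
    (1 + Complex.exp (z * pole c)) *
      (∫ x : ℝ, Complex.exp (z * (x + midHeight c * Complex.I)) *
        (Complex.sinh (c * (x + midHeight c * Complex.I)))⁻¹) =
      -(2 * pole c * Complex.exp (z * pole c)) := by
  set p := pole c with hp
  set η := midHeight c with hη
  have hη0 : 0 < η := midHeight_pos hc
  have hpη : p.im = 2 * η := by rw [hη, midHeight]; ring
  set f : ℂ → ℂ := fun t => Complex.exp (z * t) * (Complex.sinh (c * t))⁻¹ with hf
  have hδ : 0 < c.re - |z.re| := by linarith
  have hcp := mul_pole hc
  have hsp : Complex.sinh (c * p) = 0 := by rw [hcp, Complex.sinh_mul_I]; simp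
  have hc0 := ne_zero_of_re_pos hc
  -- `k` is `sinh(ct) / (t - p)` with the singularity filled in, so `E = e^{zt}/k` is regular at `p`
  -- and `E p` is the residue. `G`, the divided difference of `E`, is then the integrand minus its
  -- principal part.
  set k : ℂ → ℂ := dslope (fun t => Complex.sinh (c * t)) p with hk
  have hkd : Differentiable ℂ k := by
    have := (Complex.differentiableOn_dslope (c := p) (s := Set.univ) univ_mem
      (f := fun t => Complex.sinh (c * t))).2 (by fun_prop)
    exact differentiableOn_univ.1 this
  have hkp : k p = -c := by
    have h1 : HasDerivAt (fun t => Complex.sinh (c * t)) (Complex.cosh (c * p) * (c * 1)) p :=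
      ((hasDerivAt_id p).const_mul c).csinh
    rw [hk, dslope_same, h1.deriv, hcp, Complex.cosh_mul_I]; simp
  have hkt : ∀ t, t ≠ p → k t = Complex.sinh (c * t) / (t - p) := by
    intro t ht
    rw [hk, dslope_of_ne _ ht, slope_def_field, hsp, sub_zero]
  have hne : ∀ t : ℂ, t.im ∈ Set.Icc η (3 * η) → t ≠ p → Complex.sinh (c * t) ≠ 0 :=
    fun t ht htp h => htp (eq_pole_of_sinh_mul_eq_zero hc (by linarith [ht.1])
      (by rw [← hp]; linarith [ht.2]) h)
  have hk0 : ∀ t : ℂ, t.im ∈ Set.Icc η (3 * η) → k t ≠ 0 := by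
    intro t ht
    by_cases htp : t = p
    · rw [htp, hkp]; exact neg_ne_zero.2 hc0
    · rw [hkt t htp]
      exact div_ne_zero (hne t ht htp) (sub_ne_zero.2 htp)
  set E : ℂ → ℂ := fun t => Complex.exp (z * t) / k t with hE
  have hEd : ∀ t : ℂ, t.im ∈ Set.Icc η (3 * η) → DifferentiableAt ℂ E t := fun t ht =>
    DifferentiableAt.div (by fun_prop) (hkd t) (hk0 t ht)
  set G : ℂ → ℂ := dslope E p with hG
  have hpmem : p.im ∈ Set.Icc η (3 * η) := ⟨by linarith, by linarith⟩
  have hGt : ∀ t, t ≠ p → G t = f t - E p * (t - p)⁻¹ := by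
    intro t ht
    have := sub_ne_zero.2 ht
    rw [hG, dslope_of_ne _ ht, slope_def_field, sub_div, ← div_eq_mul_inv]
    congr 1
    simp only [hE, hf]
    rw [hkt t ht]
    -- At the other zeros of `sinh(ct)` both sides are `0` by the convention for division by zero.
    by_cases hs : Complex.sinh (c * t) = 0
    · simp [hs]
    · field_simp
  have hGd : ∀ t : ℂ, t.im ∈ Set.Icc η (3 * η) → t ∉ ({p} : Set ℂ) → DifferentiableAt ℂ G t :=
    fun t ht htp => (differentiableAt_dslope_of_ne htp).2 (hEd t ht)
  have hGc : ∀ t : ℂ, t.im ∈ Set.Icc η (3 * η) → ContinuousAt G t := by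
    intro t ht
    by_cases htp : t = p
    · rw [htp]; exact continuousAt_dslope_same.2 (hEd p hpmem)
    · exact (hGd t ht htp).continuousAt
  have hGlim : Tendsto G (stripEnds η (3 * η)) (𝓝 0) := by
    set F : Set ℂ := {t | t.im ∈ Set.Icc η (3 * η) ∧ |p.re| + 1 ≤ |t.re|} with hF
    have hFp : ∀ t ∈ F, t ≠ p := by
      rintro t ht rfl
      linarith [ht.2]
    have hFc : IsClosed F :=
      (isClosed_Icc.preimage Complex.continuous_im).inter
        (isClosed_le continuous_const Complex.continuous_re.abs)
    have hFs : F ∈ stripEnds η (3 * η) := mem_stripEnds_of (|p.re| + 1) fun t h1 h2 => ⟨h2, h1⟩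
    have hfF : ExpDecay (c.re - |z.re|) f F :=
      expDecay_exp_mul_inv_sinh hc hFc (B := 3 * η)
        (fun t ht => abs_le.2 ⟨by linarith [ht.1.1], ht.1.2⟩) fun t ht => hne t ht.1 (hFp t ht)
    have h1 := (hfF.tendsto hδ hFs).sub ((tendsto_inv_sub_stripEnds p η (3 * η)).const_mul (E p))
    rw [mul_zero, sub_zero] at h1
    refine h1.congr' ?_
    filter_upwards [hFs] with t ht using (hGt t (hFp t ht)).symm
  have hfint : ∀ y : ℝ, y ∈ Set.Icc η (3 * η) → y ≠ 2 * η →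
      Integrable fun x : ℝ => f (x + y * Complex.I) := by
    intro y hy hy2
    have hsn : ∀ t ∈ {t : ℂ | t.im = y}, Complex.sinh (c * t) ≠ 0 := by
      rintro t (rfl : t.im = y)
      refine hne t hy ?_
      rintro rfl
      exact hy2 hpη
    have h1 : ExpDecay (c.re - |z.re|) f {t : ℂ | t.im = y} :=
      expDecay_exp_mul_inv_sinh hc (isClosed_im_eq y) (B := |y|)
        (fun t ht => by rw [show t.im = y from ht]) hsn
    rw [← integrableOn_univ]
    exact h1.integrableOn hδ MeasurableSet.univ (fun x _ => by simp)
      fun t ht => (differentiableAt_exp_mul_inv_sinh (hsn t ht)).continuousAt.continuousWithinAt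
  have hi1 := hfint η ⟨le_rfl, by linarith⟩ (by linarith)
  have hi3 := hfint (3 * η) ⟨by linarith, le_rfl⟩ (by linarith)
  have hpeq : p = p.re + (2 * η : ℝ) * Complex.I := by
    rw [← hpη]; exact (Complex.re_add_im p).symm
  have hdiff : ∀ x : ℝ, G (x + η * Complex.I) - G (x + (3 * η : ℝ) * Complex.I) =
      (f (x + η * Complex.I) - f (x + (3 * η : ℝ) * Complex.I)) -
        E p * ((((x - p.re : ℝ) : ℂ) - η * Complex.I)⁻¹ -
          (((x - p.re : ℝ) : ℂ) + η * Complex.I)⁻¹) := by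
    intro x
    have n1 : (x + η * Complex.I : ℂ) ≠ p := by
      intro h; have := congrArg Complex.im h; simp [hpη] at this; linarith
    have n3 : (x + (3 * η : ℝ) * Complex.I : ℂ) ≠ p := by
      intro h; have := congrArg Complex.im h; simp [hpη] at this; linarith
    have e1 : (x + η * Complex.I : ℂ) - p = ((x - p.re : ℝ) : ℂ) - η * Complex.I := by
      nth_rewrite 1 [hpeq]; push_cast; ring
    have e3 : (x + (3 * η : ℝ) * Complex.I : ℂ) - p = ((x - p.re : ℝ) : ℂ) + η * Complex.I := by
      nth_rewrite 1 [hpeq]; push_cast; ring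
    rw [hGt _ n1, hGt _ n3, e1, e3]
    ring
  have hJ := (integrable_inv_sub_inv_conj hη0 p.re).const_mul (E p)
  have hi13 : Integrable fun x : ℝ =>
      f (x + η * Complex.I) - f (x + (3 * η : ℝ) * Complex.I) := hi1.sub hi3
  -- The heights `η` and `3η` are symmetric about `Im p = 2η`, so the principal parts combine to a
  -- Poisson kernel with integral `2πi`.
  have hzero := strip_integral_sub_eq_zero (by linarith : η ≤ 3 * η) (Set.countable_singleton p)
    hGc hGd hGlim (by simp_rw [hdiff]; exact hi13.sub hJ)
  simp_rw [hdiff] at hzero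
  rw [integral_sub hi13 hJ, integral_const_mul, integral_inv_sub_inv_conj hη0] at hzero
  have hsub := integral_sub hi1 hi3
  have hshift : ∫ x : ℝ, f (x + (3 * η : ℝ) * Complex.I) =
      -Complex.exp (z * p) * ∫ x : ℝ, f (x + η * Complex.I) := by
    rw [← integral_const_mul,
      ← integral_sub_right_eq_self (fun x : ℝ => -Complex.exp (z * p) * f (x + η * Complex.I)) p.re]
    congr 1
    ext x
    have e : (x + (3 * η : ℝ) * Complex.I : ℂ) = ((x - p.re : ℝ) + η * Complex.I) + p := by
      nth_rewrite 2 [hpeq]; push_cast; ring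
    rw [e]
    simp only [hf]
    rw [mul_add z _ p, mul_add c _ p, hcp, Complex.exp_add, Complex.sinh_add, Complex.sinh_mul_I,
      Complex.cosh_mul_I]
    simp only [Complex.sin_pi, Complex.cos_pi]
    ring_nf
  rw [hshift] at hsub
  have hEp : E p = -(Complex.exp (z * p) / c) := by
    simp only [hE]; rw [hkp, div_neg]
  rw [hsub, hEp] at hzero
  have hpc : p = π * Complex.I / c := rfl
  rw [show (2 * p * Complex.exp (z * p)) =
    Complex.exp (z * p) / c * (2 * π * Complex.I) by nth_rewrite 1 [hpc]; ring]
  linear_combination hzero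

/-! ### Closed form of the kernel with a single `sinh` -/

/-- The Faddeev-type integral `∫ e^{zt} / (t sinh(ct)) dt` along the midline. -/
noncomputable def logKernel (c z : ℂ) : ℂ :=
  ∫ x : ℝ, Complex.exp (z * (x + midHeight c * Complex.I)) *
    ((Complex.sinh (c * (x + midHeight c * Complex.I)))⁻¹ * (x + midHeight c * Complex.I)⁻¹)

lemma sinh_mul_ne_zero_of_midHeight {c : ℂ} (hc : 0 < c.re) {t : ℂ} (ht : t.im = midHeight c) :
    t ≠ 0 ∧ Complex.sinh (c * t) ≠ 0 := by
  have h := midHeight_pos hc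
  have h0 : t ≠ 0 := by rintro rfl; simp at ht; linarith
  refine ⟨h0, sinh_mul_ne_zero_of_im hc h0 (by linarith) ?_⟩
  rw [midHeight] at h ht
  linarith

lemma expDecay_inv_sinh_mul_inv {c : ℂ} (hc : 0 < c.re) {F : Set ℂ} (hF : IsClosed F) {B r : ℝ}
    (hr : 0 < r) (hn : ∀ t ∈ F, r ≤ ‖t‖)
    (hB : ∀ t ∈ F, |t.im| ≤ B) (h0 : ∀ t ∈ F, Complex.sinh (c * t) ≠ 0) :
    ExpDecay c.re (fun t => (Complex.sinh (c * t))⁻¹ * t⁻¹) F := by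
  have := (expDecay_inv_sinh hc hF hB h0).mul (expDecay_inv hr hn)
  rwa [add_zero] at this

lemma continuousOn_inv_sinh_mul_inv {c : ℂ} {F : Set ℂ} (hn : ∀ t ∈ F, t ≠ 0)
    (h0 : ∀ t ∈ F, Complex.sinh (c * t) ≠ 0) :
    ContinuousOn (fun t => (Complex.sinh (c * t))⁻¹ * t⁻¹) F := by
  intro t ht
  have := hn t ht
  have := h0 t ht
  have : DifferentiableAt ℂ (fun t => (Complex.sinh (c * t))⁻¹ * t⁻¹) t := by
    fun_prop (disch := assumption)
  exact this.continuousAt.continuousWithinAt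

lemma expDecay_midHeight {c : ℂ} (hc : 0 < c.re) :
    ExpDecay c.re (fun t => (Complex.sinh (c * t))⁻¹ * t⁻¹) {t : ℂ | t.im = midHeight c} :=
  expDecay_inv_sinh_mul_inv hc (isClosed_im_eq _) (midHeight_pos hc)
    (fun t ht => by
      rw [← show t.im = midHeight c from ht]
      exact (le_abs_self _).trans (Complex.abs_im_le_norm t))
    (B := |midHeight c|) (fun t ht => by rw [show t.im = midHeight c from ht])
    (fun t ht => (sinh_mul_ne_zero_of_midHeight hc ht).2)

lemma hasDerivAt_logKernel {c z : ℂ} (hc : 0 < c.re) (hz : |z.re| < c.re) :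
    HasDerivAt (logKernel c) (∫ x : ℝ, Complex.exp (z * (x + midHeight c * Complex.I)) *
        (Complex.sinh (c * (x + midHeight c * Complex.I)))⁻¹) z := by
  have h := hasDerivAt_line_exp_mul (expDecay_midHeight hc)
    (continuousOn_inv_sinh_mul_inv (fun t ht => (sinh_mul_ne_zero_of_midHeight hc ht).1)
      (fun t ht => (sinh_mul_ne_zero_of_midHeight hc ht).2)) hz
  refine h.congr_deriv ?_
  congr 1
  ext x
  have := (sinh_mul_ne_zero_of_midHeight hc
    (t := x + midHeight c * Complex.I) (by simp)).1
  field_simp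

/-- The logarithmic derivative of the product vanishes by the residue computation, so the product is
constant on the connected strip; the constant is found as `z = iy`, `y → +∞`. -/
lemma exp_logKernel {c z : ℂ} (hc : 0 < c.re) (hz : |z.re| < c.re) :
    (1 + Complex.exp (z * pole c)) * Complex.exp (1 / 2 * logKernel c z) = 1 := by
  set V : ℂ → ℂ := fun z => (1 + Complex.exp (z * pole c)) * Complex.exp (1 / 2 * logKernel c z)
    with hV
  have hVd : ∀ w : ℂ, |w.re| < c.re → HasDerivAt V 0 w := by
    intro w hw
    have h1 : HasDerivAt (fun w : ℂ => w * pole c) (1 * pole c) w :=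
      (hasDerivAt_id w).mul_const _
    have h2 := (h1.cexp.const_add 1).mul ((hasDerivAt_logKernel hc hw).const_mul (1 / 2)).cexp
    refine h2.congr_deriv ?_
    linear_combination (1 / 2 * Complex.exp (1 / 2 * logKernel c w)) *
      line_integral_exp_div_sinh hc hw
  set U : Set ℂ := Complex.re ⁻¹' Set.Ioo (-c.re) c.re with hU
  have hUo : IsOpen U := isOpen_Ioo.preimage Complex.continuous_re
  have hUc : IsPreconnected U :=
    ((convex_Ioo (-c.re) c.re).linear_preimage Complex.reLm).isPreconnected
  have hmem : ∀ w : ℂ, w ∈ U ↔ |w.re| < c.re := fun w => abs_lt.symm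
  have hconst : ∀ w ∈ U, V w = V z := fun w hw =>
    hUo.is_const_of_deriv_eq_zero hUc
      (fun w hw => (hVd w ((hmem w).1 hw)).differentiableAt.differentiableWithinAt)
      (fun w hw => (hVd w ((hmem w).1 hw)).deriv) hw ((hmem z).2 hz)
  have hp := pole_im_pos hc
  have hη := midHeight_pos hc
  -- Both the pole and the line of integration lie above the real axis, so `e^{iyt}` decays at the
  -- pole and uniformly on the line.
  have hexp : Tendsto (fun y : ℝ => Complex.exp (y * Complex.I * pole c)) atTop (𝓝 0) := by
    rw [Complex.tendsto_exp_nhds_zero_iff]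
    have : (fun y : ℝ => (y * Complex.I * pole c : ℂ).re) = fun y => y * (-(pole c).im) := by
      ext y; simp
    rw [this]
    exact tendsto_id.atTop_mul_const_of_neg (by linarith)
  have hker : Tendsto (fun y : ℝ => logKernel c (y * Complex.I)) atTop (𝓝 0) := by
    set g : ℂ → ℂ := fun t => (Complex.sinh (c * t))⁻¹ * t⁻¹ with hg
    have hb : ∀ y : ℝ, ‖logKernel c (y * Complex.I)‖ ≤
        Real.exp (y * -midHeight c) * ∫ x : ℝ, ‖g (x + midHeight c * Complex.I)‖ := by
      intro y
      rw [← integral_const_mul]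
      refine (norm_integral_le_integral_norm _).trans (le_of_eq ?_)
      congr 1
      ext x
      rw [norm_mul, Complex.norm_exp]
      simp [hg]
    have h1 : Tendsto (fun y : ℝ => Real.exp (y * -midHeight c)) atTop (𝓝 0) :=
      Real.tendsto_exp_atBot.comp (tendsto_id.atTop_mul_const_of_neg (by linarith))
    have h2 := h1.mul_const (∫ x : ℝ, ‖g (x + midHeight c * Complex.I)‖)
    rw [zero_mul] at h2
    exact squeeze_zero_norm hb h2
  have hlim : Tendsto (fun y : ℝ => V (y * Complex.I)) atTop (𝓝 ((1 + 0) *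
      Complex.exp (1 / 2 * 0))) :=
    (hexp.const_add 1).mul ((Complex.continuous_exp.tendsto _).comp (hker.const_mul (1 / 2)))
  have hlim2 : Tendsto (fun y : ℝ => V (y * Complex.I)) atTop (𝓝 (V z)) := by
    refine tendsto_const_nhds.congr fun y => (hconst _ ((hmem _).2 ?_)).symm
    simpa using hc
  exact (tendsto_nhds_unique hlim2 hlim).trans (by simp)

/-! ### The two functional equations -/

/-- The factor `1 / (sinh(ct) sinh(dt) t)` of the integrand of the quantum dilogarithm. -/
noncomputable def weight (c d t : ℂ) : ℂ :=
  (Complex.sinh (c * t))⁻¹ * ((Complex.sinh (d * t))⁻¹ * t⁻¹)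

lemma integrand_eq (γ z : ℂ) : integrand γ z = fun t => Complex.exp (z * t) * weight π γ t := by
  ext t
  rw [integrand, weight, div_eq_mul_inv, mul_inv, mul_inv, mul_assoc]

lemma expDecay_weight {c d : ℂ} (hc : 0 < c.re) (hd : 0 < d.re) {F : Set ℂ} (hF : IsClosed F)
    {B r : ℝ} (hr : 0 < r) (hn : ∀ t ∈ F, r ≤ ‖t‖) (hB : ∀ t ∈ F, |t.im| ≤ B)
    (hc0 : ∀ t ∈ F, Complex.sinh (c * t) ≠ 0) (hd0 : ∀ t ∈ F, Complex.sinh (d * t) ≠ 0) :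
    ExpDecay (c.re + d.re) (weight c d) F :=
  (expDecay_inv_sinh hc hF hB hc0).mul (expDecay_inv_sinh_mul_inv hd hF hr hn hB hd0)

lemma differentiableAt_weight {c d t : ℂ} (ht : t ≠ 0) (hc : Complex.sinh (c * t) ≠ 0)
    (hd : Complex.sinh (d * t) ≠ 0) : DifferentiableAt ℂ (weight c d) t := by
  unfold weight
  fun_prop (disch := assumption)

/-- The integral `∫ e^{zt} / (sinh(ct) sinh(dt) t) dt` along the line `Im t = h`. -/
noncomputable def lineIntegral (h : ℝ) (c d z : ℂ) : ℂ :=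
  ∫ x : ℝ, Complex.exp (z * (x + h * Complex.I)) * weight c d (x + h * Complex.I)

lemma sinh_mul_ne_zero_of_im_eq {c : ℂ} (hc : 0 < c.re) {h : ℝ} (hh : 0 < h)
    (hhc : h ≤ midHeight c) {t : ℂ} (ht : t.im = h) : t ≠ 0 ∧ Complex.sinh (c * t) ≠ 0 := by
  have h0 : t ≠ 0 := by rintro rfl; simp at ht; linarith
  have := pole_im_pos hc
  rw [midHeight] at hhc
  exact ⟨h0, sinh_mul_ne_zero_of_im hc h0 (by linarith) (by linarith)⟩

lemma expDecay_weight_line {c d : ℂ} (hc : 0 < c.re) (hd : 0 < d.re) {h : ℝ} (hh : 0 < h)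
    (hhc : h ≤ midHeight c) (hhd : h ≤ midHeight d) :
    ExpDecay (c.re + d.re) (weight c d) {t | t.im = h} :=
  expDecay_weight hc hd (isClosed_im_eq h) hh
    (fun t (ht : t.im = h) => ht ▸ (le_abs_self _).trans (Complex.abs_im_le_norm t))
    (B := |h|) (fun t (ht : t.im = h) => by rw [ht])
    (fun t ht => (sinh_mul_ne_zero_of_im_eq hc hh hhc ht).2)
    (fun t ht => (sinh_mul_ne_zero_of_im_eq hd hh hhd ht).2)

lemma continuousOn_weight_line {c d : ℂ} (hc : 0 < c.re) (hd : 0 < d.re) {h : ℝ} (hh : 0 < h)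
    (hhc : h ≤ midHeight c) (hhd : h ≤ midHeight d) :
    ContinuousOn (weight c d) {t | t.im = h} := fun _ ht =>
  (differentiableAt_weight (sinh_mul_ne_zero_of_im_eq hc hh hhc ht).1
    (sinh_mul_ne_zero_of_im_eq hc hh hhc ht).2
    (sinh_mul_ne_zero_of_im_eq hd hh hhd ht).2).continuousAt.continuousWithinAt

lemma continuousAt_lineIntegral {c d z : ℂ} (hc : 0 < c.re) (hd : 0 < d.re) {h : ℝ} (hh : 0 < h)
    (hhc : h ≤ midHeight c) (hhd : h ≤ midHeight d) (hz : |z.re| < c.re + d.re) :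
    ContinuousAt (lineIntegral h c d) z :=
  (hasDerivAt_line_exp_mul (expDecay_weight_line hc hd hh hhc hhd)
    (continuousOn_weight_line hc hd hh hhc hhd) hz).continuousAt

/-- This symmetry makes the shift by `π` and the shift by `γ` instances of one lemma. -/
lemma lineIntegral_comm (h : ℝ) (c d z : ℂ) : lineIntegral h c d z = lineIntegral h d c z := by
  simp only [lineIntegral, weight]
  congr 1
  ext x
  ring

/-- The integrand has no pole between the two lines. The closed form is known on the midline for
`c`, whereas both functional equations need a common `h` below the midlines for `π` and for `γ`. -/
lemma logKernel_eq_line {c z : ℂ} (hc : 0 < c.re) {h : ℝ} (hh : 0 < h) (hhc : h ≤ midHeight c)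
    (hz : |z.re| < c.re) :
    ∫ x : ℝ, Complex.exp (z * (x + h * Complex.I)) *
      ((Complex.sinh (c * (x + h * Complex.I)))⁻¹ * (x + h * Complex.I)⁻¹) = logKernel c z := by
  set f : ℂ → ℂ := fun t => Complex.exp (z * t) * ((Complex.sinh (c * t))⁻¹ * t⁻¹) with hf
  set F : Set ℂ := {t | t.im ∈ Set.Icc h (midHeight c)} with hF
  have hFc : IsClosed F := isClosed_Icc.preimage Complex.continuous_im
  have hne : ∀ t ∈ F, t ≠ 0 ∧ Complex.sinh (c * t) ≠ 0 := fun t ht =>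
    sinh_mul_ne_zero_of_im_eq hc (hh.trans_le ht.1) ht.2 rfl
  have hB : ∀ t ∈ F, |t.im| ≤ midHeight c := fun t ht =>
    abs_le.2 ⟨by linarith [ht.1, ht.2], ht.2⟩
  have hdec : ExpDecay (-|z.re| + c.re) f F := (expDecay_exp z hB).mul
    (expDecay_inv_sinh_mul_inv hc hFc hh
      (fun t ht => (ht.1.trans (le_abs_self _)).trans (Complex.abs_im_le_norm t)) hB
      (fun t ht => (hne t ht).2))
  have hfd : ∀ t ∈ F, DifferentiableAt ℂ f t := by
    intro t ht
    have h1 := (hne t ht).1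
    have h2 := (hne t ht).2
    simp only [hf]
    fun_prop (disch := assumption)
  have hint : ∀ y ∈ Set.Icc h (midHeight c), Integrable fun x : ℝ => f (x + y * Complex.I) := by
    intro y hy
    rw [← integrableOn_univ]
    exact hdec.integrableOn (by linarith) MeasurableSet.univ (fun x _ => by simpa [hF] using hy)
      fun t ht => (hfd t ht).continuousAt.continuousWithinAt
  have i1 := hint h ⟨le_rfl, hhc⟩
  have i2 := hint (midHeight c) ⟨hhc, le_rfl⟩
  have := strip_integral_sub_eq_zero hhc Set.countable_empty
    (fun t ht => (hfd t ht).continuousAt) (fun t ht _ => hfd t ht)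
    (hdec.tendsto (by linarith) (mem_stripEnds_of 0 fun t _ ht => ht)) (i1.sub i2)
  rw [integral_sub i1 i2] at this
  exact sub_eq_zero.1 this

lemma lineIntegral_shift {c d z : ℂ} (hc : 0 < c.re) (hd : 0 < d.re) {h : ℝ} (hh : 0 < h)
    (hhc : h ≤ midHeight c) (hhd : h ≤ midHeight d) (hz : |z.re| < c.re) :
    lineIntegral h c d (z - d) = lineIntegral h c d (z + d) - 2 * logKernel c z := by
  have hw := expDecay_weight_line hc hd hh hhc hhd
  have hwc := continuousOn_weight_line hc hd hh hhc hhd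
  have hz' := abs_lt.1 hz
  have i1 := integrable_line_exp_mul hw hwc (z := z - d)
    (abs_lt.2 ⟨by rw [Complex.sub_re]; linarith, by rw [Complex.sub_re]; linarith⟩)
  have i2 := integrable_line_exp_mul hw hwc (z := z + d)
    (abs_lt.2 ⟨by rw [Complex.add_re]; linarith, by rw [Complex.add_re]; linarith⟩)
  rw [← logKernel_eq_line hc hh hhc hz, ← integral_const_mul, eq_sub_iff_add_eq',
    ← eq_sub_iff_add_eq, lineIntegral, lineIntegral, ← integral_sub i2 i1]
  congr 1
  ext x
  have h1 := sinh_mul_ne_zero_of_im_eq hd hh hhd (t := x + h * Complex.I) (by simp)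
  set t : ℂ := x + h * Complex.I
  have e : Complex.exp ((z + d) * t) - Complex.exp ((z - d) * t) =
      2 * Complex.exp (z * t) * Complex.sinh (d * t) := by
    rw [add_mul, sub_mul, Complex.exp_add, sub_eq_add_neg (z * t), Complex.exp_add, Complex.sinh]
    ring
  rw [← sub_mul, e, weight]
  linear_combination (-(2 * Complex.exp (z * t) * (Complex.sinh (c * t))⁻¹ * t⁻¹)) *
    mul_inv_cancel₀ h1.2

/-- The quantum dilogarithm computed along the line `Im t = h`. -/
noncomputable def lineS (h : ℝ) (γ z : ℂ) : ℂ :=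
  Complex.exp (1 / 4 * lineIntegral h π γ z)

lemma exp_quarter_shift {c A B z : ℂ} (hc : 0 < c.re) (hz : |z.re| < c.re)
    (hAB : A = B - 2 * logKernel c z) :
    Complex.exp (1 / 4 * A) = (1 + Complex.exp (z * pole c)) * Complex.exp (1 / 4 * B) := by
  have h := exp_logKernel hc hz
  have e : Complex.exp (1 / 4 * B) =
      Complex.exp (1 / 4 * A) * Complex.exp (1 / 2 * logKernel c z) := by
    rw [← Complex.exp_add, hAB]; congr 1; ring
  rw [e]
  linear_combination (-Complex.exp (1 / 4 * A)) * h

lemma pi_re_pos : 0 < (π : ℂ).re := by simpa using Real.pi_pos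

lemma pole_pi : pole π = Complex.I := by
  have := Complex.ofReal_ne_zero.2 Real.pi_ne_zero
  rw [pole]; field_simp

lemma lineS_sub_gamma {γ z : ℂ} (hγ : 0 < γ.re) {h : ℝ} (hh : 0 < h)
    (hhc : h ≤ midHeight π) (hhd : h ≤ midHeight γ) (hz : |z.re| < π) :
    lineS h γ (z - γ) = (1 + Complex.exp (z * Complex.I)) * lineS h γ (z + γ) := by
  have hz' : |z.re| < (π : ℂ).re := by simpa using hz
  have := exp_quarter_shift pi_re_pos hz'
    (lineIntegral_shift pi_re_pos hγ hh hhc hhd hz')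
  rwa [pole_pi] at this

lemma lineS_sub_pi {γ z : ℂ} (hγ : 0 < γ.re) {h : ℝ} (hh : 0 < h)
    (hhc : h ≤ midHeight π) (hhd : h ≤ midHeight γ) (hz : |z.re| < γ.re) :
    lineS h γ (z - π) = (1 + Complex.exp (z * pole γ)) * lineS h γ (z + π) := by
  rw [lineS, lineS, lineIntegral_comm, lineIntegral_comm h π γ]
  exact exp_quarter_shift hγ hz (lineIntegral_shift hγ pi_re_pos hh hhd hhc hz)

lemma continuousAt_lineS {γ z : ℂ} (hγ : 0 < γ.re) {h : ℝ} (hh : 0 < h)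
    (hhc : h ≤ midHeight π) (hhd : h ≤ midHeight γ) (hz : |z.re| < π + γ.re) :
    ContinuousAt (lineS h γ) z :=
  Complex.continuous_exp.continuousAt.comp (continuousAt_const.mul
    (continuousAt_lineIntegral pi_re_pos hγ hh hhc hhd (by simpa using hz)))

lemma lineS_ladder {γ z : ℂ} (hγ : 0 < γ.re) {h : ℝ} (hh : 0 < h)
    (hhc : h ≤ midHeight π) (hhd : h ≤ midHeight γ) (m : ℕ)
    (hz : ∀ k < m, |(z - 2 * k * γ).re| < π) :
    lineS h γ (z - (2 * m - 1) * γ) =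
      (∏ k ∈ Finset.range m, (1 + Complex.exp ((z - 2 * k * γ) * Complex.I))) *
        lineS h γ (z + γ) := by
  induction m with
  | zero => simp
  | succ m ih =>
    have h1 := lineS_sub_gamma hγ hh hhc hhd (hz m (Nat.lt_succ_self m))
    rw [Finset.prod_range_succ]
    have e1 : z - (2 * ((m + 1 : ℕ) : ℂ) - 1) * γ = z - 2 * m * γ - γ := by push_cast; ring
    have e2 : z - 2 * m * γ + γ = z - (2 * m - 1) * γ := by ring
    rw [e1, h1, e2, ih fun k hk => hz k (hk.trans (Nat.lt_succ_self m))]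
    ring

/-- Both functional equations combined; the point `π + v + γ` that links them lies on the
boundary of the strip, so they are applied slightly to the left of it. -/
lemma lineS_quotient {γ v : ℂ} (hγ : 0 < γ.re) (hv : v.re = 0) {h : ℝ} (hh : 0 < h)
    (hhc : h ≤ midHeight π) (hhd : h ≤ midHeight γ) (m : ℕ) (hm : ((m : ℝ) - 1) * γ.re < π)
    (hm1 : 1 ≤ m) :
    lineS h γ (-π + v + γ) *
        ∏ k ∈ Finset.range m, (1 + Complex.exp ((π + v - 2 * k * γ) * Complex.I)) =
      (1 + Complex.exp ((v + γ) * pole γ)) * lineS h γ (π + v - (2 * m - 1) * γ) := by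
  have hπ := Real.pi_pos
  have hm1' : (1 : ℝ) ≤ m := by exact_mod_cast hm1
  have ca := continuousAt_lineS hγ hh hhc hhd (z := -π + v + γ) (by
    rw [abs_lt]; simp [hv]; constructor <;> linarith)
  have cb := continuousAt_lineS hγ hh hhc hhd (z := π + v - (2 * m - 1) * γ) (by
    rw [abs_lt]; simp [hv]; constructor <;> nlinarith)
  have hz : ∀ w : ℂ, Tendsto (fun ε : ℝ => w - ε) (𝓝[>] 0) (𝓝 w) := by
    intro w
    have : Tendsto (fun ε : ℝ => w - ε) (𝓝 0) (𝓝 (w - (0 : ℝ))) :=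
      Continuous.tendsto (by fun_prop) 0
    rw [Complex.ofReal_zero, sub_zero] at this
    exact this.mono_left nhdsWithin_le_nhds
  have ta := ca.tendsto.comp (hz _)
  have tb := cb.tendsto.comp (hz _)
  have tA : Tendsto (fun ε : ℝ => 1 + Complex.exp ((v + γ - ε) * pole γ)) (𝓝[>] 0)
      (𝓝 (1 + Complex.exp ((v + γ) * pole γ))) :=
    ((Continuous.tendsto (by fun_prop : Continuous fun w : ℂ =>
      1 + Complex.exp (w * pole γ)) _).comp (hz _))
  have tP : Tendsto (fun ε : ℝ => ∏ k ∈ Finset.range m,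
        (1 + Complex.exp ((π + v - ε - 2 * k * γ) * Complex.I))) (𝓝[>] 0)
      (𝓝 (∏ k ∈ Finset.range m, (1 + Complex.exp ((π + v - 2 * k * γ) * Complex.I)))) :=
    ((Continuous.tendsto (by fun_prop : Continuous fun w : ℂ => ∏ k ∈ Finset.range m,
        (1 + Complex.exp ((w - 2 * k * γ) * Complex.I))) _).comp (hz _))
  refine tendsto_nhds_unique ((ta.mul tP).congr' ?_) (tA.mul tb)
  -- The first bound keeps `v + γ - ε` in the strip for the shift by `π`; the second keeps the last
  -- point of the ladder, `k = m - 1`, to the right of `Re = -π`.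
  have hε1 : Set.Ioo 0 (min γ.re (2 * π - 2 * ((m : ℝ) - 1) * γ.re)) ∈ 𝓝[>] (0 : ℝ) :=
    Ioo_mem_nhdsGT (lt_min hγ (by linarith))
  filter_upwards [hε1] with ε hε
  have hε0 := hε.1
  have hε2 := hε.2.trans_le (min_le_left _ _)
  have hε3 := hε.2.trans_le (min_le_right _ _)
  have f1 := lineS_sub_pi hγ hh hhc hhd (z := v + γ - ε) (by
    rw [abs_lt]; simp [hv]; constructor <;> linarith)
  have f2 := lineS_ladder hγ hh hhc hhd m (z := π + v - ε) (by
    intro k hk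
    have hk' : (k : ℝ) ≤ m - 1 := by
      have : (k : ℝ) + 1 ≤ m := by exact_mod_cast hk
      linarith
    have := mul_le_mul_of_nonneg_right hk' hγ.le
    have h0 : 0 ≤ (k : ℝ) * γ.re := by positivity
    rw [abs_lt]; simp [hv]; constructor <;> nlinarith)
  have e1 : -π + v + γ - (ε : ℂ) = v + γ - ε - π := by ring
  have e2 : π + v - (2 * m - 1) * γ - (ε : ℂ) = π + v - ε - (2 * m - 1) * γ := by ring
  have e3 : v + γ - ε + (π : ℂ) = π + v - ε + γ := by ring
  simp only [Function.comp]
  rw [e1, e2, f1, f2, e3]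
  ring

/-! ### The contour definition of `S` agrees with the line version -/

lemma differentiableAt_integrand {γ z t : ℂ} (ht : t ≠ 0) (h1 : Complex.sinh (π * t) ≠ 0)
    (h2 : Complex.sinh (γ * t) ≠ 0) : DifferentiableAt ℂ (integrand γ z) t := by
  rw [integrand_eq]
  exact DifferentiableAt.mul (by fun_prop) (differentiableAt_weight ht h1 h2)

lemma expDecay_integrand {γ z : ℂ} (hγ : 0 < γ.re) {F : Set ℂ} (hF : IsClosed F)
    {B r : ℝ} (hr : 0 < r) (hn : ∀ t ∈ F, r ≤ ‖t‖) (hB : ∀ t ∈ F, |t.im| ≤ B)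
    (hc0 : ∀ t ∈ F, Complex.sinh (π * t) ≠ 0) (hd0 : ∀ t ∈ F, Complex.sinh (γ * t) ≠ 0) :
    ExpDecay (π + γ.re - |z.re|) (integrand γ z) F := by
  have := (expDecay_exp z hB).mul (expDecay_weight pi_re_pos hγ hF hr hn hB hc0 hd0)
  rw [neg_add_eq_sub, Complex.ofReal_re] at this
  rwa [integrand_eq]

/-- The strip `0 ≤ Im t ≤ h` with `|Re t| < R` cut out. -/
def outerStrip (R h : ℝ) : Set ℂ := {t | t.im ∈ Set.Icc 0 h ∧ R ≤ |t.re|}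

lemma isClosed_outerStrip (R h : ℝ) : IsClosed (outerStrip R h) :=
  (isClosed_Icc.preimage Complex.continuous_im).inter
    (isClosed_le continuous_const Complex.continuous_re.abs)

lemma sinh_mul_ne_zero_of_im_mem_Icc {c : ℂ} (hc : 0 < c.re) {h : ℝ} (hh : h ≤ midHeight c)
    {t : ℂ} (h0 : t ≠ 0) (ht : t.im ∈ Set.Icc 0 h) : Complex.sinh (c * t) ≠ 0 := by
  have := pole_im_pos hc
  rw [midHeight] at hh
  exact sinh_mul_ne_zero_of_im hc h0 ht.1 (by linarith [ht.2])

lemma expDecay_integrand_outerStrip {γ z : ℂ} (hγ : 0 < γ.re) {R h : ℝ} (hR : 0 < R)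
    (hhc : h ≤ midHeight π) (hhd : h ≤ midHeight γ) :
    ExpDecay (π + γ.re - |z.re|) (integrand γ z) (outerStrip R h) ∧
      ContinuousOn (integrand γ z) (outerStrip R h) := by
  have hn : ∀ t ∈ outerStrip R h, R ≤ ‖t‖ := fun t ht => ht.2.trans (Complex.abs_re_le_norm t)
  have h0 : ∀ t ∈ outerStrip R h, t ≠ 0 := fun t ht =>
    norm_pos_iff.1 (hR.trans_le (hn t ht))
  have h1 : ∀ t ∈ outerStrip R h, Complex.sinh (π * t) ≠ 0 := fun t ht =>
    sinh_mul_ne_zero_of_im_mem_Icc pi_re_pos hhc (h0 t ht) ht.1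
  have h2 : ∀ t ∈ outerStrip R h, Complex.sinh (γ * t) ≠ 0 := fun t ht =>
    sinh_mul_ne_zero_of_im_mem_Icc hγ hhd (h0 t ht) ht.1
  exact ⟨expDecay_integrand hγ (isClosed_outerStrip R h) hR hn (B := h)
    (fun t ht => abs_le.2 ⟨by linarith [ht.1.1, ht.1.2], ht.1.2⟩) h1 h2,
    fun t ht => (differentiableAt_integrand (h0 t ht) (h1 t ht)
      (h2 t ht)).continuousAt.continuousWithinAt⟩

lemma integrableOn_integrand {γ z : ℂ} (hγ : 0 < γ.re) {R : ℝ} (hR : 0 < R)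
    (hz : |z.re| < π + γ.re) :
    IntegrableOn (fun t : ℝ => integrand γ z t) (Set.Iic (-R)) ∧
      IntegrableOn (fun t : ℝ => integrand γ z t) (Set.Ici R) := by
  -- With height `0` the outer strip is just the two real rays.
  obtain ⟨h1, h2⟩ := expDecay_integrand_outerStrip (z := z) hγ hR (h := 0)
    (midHeight_pos pi_re_pos).le (midHeight_pos hγ).le
  constructor
  · have := h1.integrableOn (by linarith) (s := Set.Iic (-R)) measurableSet_Iic (b := 0)
      (fun x hx => ⟨by simp, by
        simpa using (by linarith [Set.mem_Iic.1 hx] : R ≤ -x).trans (neg_le_abs x)⟩) h2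
    simpa using this
  · have := h1.integrableOn (by linarith) (s := Set.Ici R) measurableSet_Ici (b := 0)
      (fun x hx => ⟨by simp, by simpa using (Set.mem_Ici.1 hx).trans (le_abs_self x)⟩) h2
    simpa using this

lemma differentiableAt_integrand_of_norm {γ z : ℂ} (hγ : 0 < γ.re) {t : ℂ} (h0 : t ≠ 0)
    (ht : ‖t‖ < min (π / ‖γ‖) 1) : DifferentiableAt ℂ (integrand γ z) t := by
  refine differentiableAt_integrand h0 (sinh_mul_ne_zero_of_norm pi_re_pos h0 ?_)
    (sinh_mul_ne_zero_of_norm hγ h0 (ht.trans_le (min_le_left _ _)))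
  have : π / ‖(π : ℂ)‖ = 1 := by
    rw [Complex.norm_real, Real.norm_of_nonneg Real.pi_pos.le, div_self Real.pi_ne_zero]
  rw [this]
  exact ht.trans_le (min_le_right _ _)

lemma contourIntegrable_integrand {γ z : ℂ} (hγ : 0 < γ.re) {R : ℝ} (hR : AdmissibleRadius γ R)
    (hz : |z.re| < π + γ.re) : ContourIntegrable R (integrand γ z) :=
  ⟨(integrableOn_integrand hγ hR.1 hz).1,
    (continuous_arcIntegrand hR.1 hR.2 fun _ h0 ht =>
      differentiableAt_integrand_of_norm hγ h0 ht).intervalIntegrable _ _,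
    (integrableOn_integrand hγ hR.1 hz).2⟩

lemma S_eq_lineS {γ z : ℂ} (hγ : 0 < γ.re) {R h : ℝ} (hR : AdmissibleRadius γ R) (hh : 0 < h)
    (hhc : h ≤ midHeight π) (hhd : h ≤ midHeight γ)
    (hRh : R ^ 2 + h ^ 2 < (min (π / ‖γ‖) 1) ^ 2) (hz : |z.re| < π + γ.re) :
    S R γ z = lineS h γ z := by
  have hδ : 0 < π + γ.re - |z.re| := by linarith
  have hi := integrableOn_integrand hγ hR.1 hz
  have hline : Integrable fun x : ℝ => integrand γ z (x + h * Complex.I) := by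
    rw [integrand_eq]
    exact integrable_line_exp_mul (expDecay_weight_line pi_re_pos hγ hh hhc hhd)
      (continuousOn_weight_line pi_re_pos hγ hh hhc hhd) (by simpa using hz)
  have := contourIntegral_eq_line hR.1 hh (hR.1.trans hR.2) hRh
    (fun t h0 ht => differentiableAt_integrand_of_norm (z := z) hγ h0 ht)
    (fun t h0 ht => differentiableAt_integrand h0
      (sinh_mul_ne_zero_of_im_mem_Icc pi_re_pos hhc h0 ht)
      (sinh_mul_ne_zero_of_im_mem_Icc hγ hhd h0 ht))
    ((expDecay_integrand_outerStrip hγ hR.1 hhc hhd).1.tendsto hδ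
      (mem_stripEnds_of R fun t h1 h2 => ⟨h2, h1⟩))
    hi.1 hi.2 hline
  rw [S, this, lineS, lineIntegral, integrand_eq]

/-- A single line must serve the radii of both numerator and denominator, so that the two values of
`S` can be compared. -/
lemma exists_line_height {γ : ℂ} (hγ : 0 < γ.re) {R R' : ℝ} (hR : AdmissibleRadius γ R)
    (hR' : AdmissibleRadius γ R') : ∃ h : ℝ, 0 < h ∧ h ≤ midHeight π ∧ h ≤ midHeight γ ∧
      R ^ 2 + h ^ 2 < (min (π / ‖γ‖) 1) ^ 2 ∧ R' ^ 2 + h ^ 2 < (min (π / ‖γ‖) 1) ^ 2 := by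
  set ρ := min (π / ‖γ‖) 1
  have t1 : Tendsto (fun h : ℝ => h) (𝓝[>] 0) (𝓝 0) := tendsto_id.mono_left nhdsWithin_le_nhds
  have t2 : ∀ Q : ℝ, Tendsto (fun h : ℝ => Q ^ 2 + h ^ 2) (𝓝[>] 0) (𝓝 (Q ^ 2 + 0 ^ 2)) :=
    fun Q => (t1.pow 2).const_add _
  have e : ∀ Q : ℝ, AdmissibleRadius γ Q → ∀ᶠ h in 𝓝[>] (0 : ℝ), Q ^ 2 + h ^ 2 < ρ ^ 2 := by
    intro Q hQ
    refine (t2 Q).eventually_lt_const ?_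
    have := hQ.1
    have : Q < ρ := hQ.2
    nlinarith
  have e1 := t1.eventually_lt_const (midHeight_pos pi_re_pos)
  have e2 := t1.eventually_lt_const (midHeight_pos hγ)
  obtain ⟨h, h0, h1, h2, h3, h4⟩ :=
    ((eventually_mem_nhdsWithin (a := (0 : ℝ)) (s := Set.Ioi 0)).and (e1.and (e2.and ((e R hR).and (e R' hR'))))).exists
  exact ⟨h, h0, h1.le, h2.le, h3, h4⟩

lemma S_ne_zero (R : ℝ) (γ z : ℂ) : S R γ z ≠ 0 := Complex.exp_ne_zero _

/-! ### The parameter `γ_N` and its limit -/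

lemma gam_eq (u : ℝ) (n N : ℕ) :
    gam u n N = ((π / ((N : ℝ) + n - 2) : ℝ) : ℂ) +
      ((-(u / (2 * ((N : ℝ) + n - 2))) : ℝ) : ℂ) * Complex.I := by
  rw [gam]
  push_cast
  rw [sub_div, mul_div_mul_left _ _ two_ne_zero]
  ring

lemma gam_re (u : ℝ) (n N : ℕ) : (gam u n N).re = π / ((N : ℝ) + n - 2) := by
  rw [gam_eq, Complex.add_re, Complex.ofReal_re, Complex.re_ofReal_mul]; simp

lemma gam_im (u : ℝ) (n N : ℕ) : (gam u n N).im = -(u / (2 * ((N : ℝ) + n - 2))) := by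
  rw [gam_eq, Complex.add_im, Complex.ofReal_im, Complex.im_ofReal_mul]; simp

lemma exp_sub_one_ne_zero {w : ℂ} (hw : 0 < w.re) : Complex.exp w - 1 ≠ 0 := by
  intro h
  have h1 : ‖Complex.exp w‖ = 1 := by rw [sub_eq_zero.1 h, norm_one]
  rw [Complex.norm_exp, Real.exp_eq_one_iff] at h1
  exact hw.ne' h1

lemma tendsto_gam (u : ℝ) (n : ℕ) : Tendsto (gam u n) atTop (𝓝 0) := by
  have h1 : Tendsto (fun N : ℕ => (N : ℝ) + ((n : ℝ) - 2)) atTop atTop :=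
    tendsto_atTop_add_const_right _ _ tendsto_natCast_atTop_atTop
  have h2 : Tendsto (fun N : ℕ => (((((N : ℝ) + ((n : ℝ) - 2))⁻¹ : ℝ)) : ℂ)) atTop
      (𝓝 ((0 : ℝ) : ℂ)) :=
    (Complex.continuous_ofReal.tendsto _).comp (tendsto_inv_atTop_zero.comp h1)
  have h3 := h2.const_mul ((2 * (π : ℂ) - Complex.I * (u : ℂ)) / 2)
  rw [Complex.ofReal_zero, mul_zero] at h3
  refine h3.congr fun N => ?_
  rw [gam]
  push_cast
  rw [← div_eq_mul_inv, div_div, add_sub_assoc]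

lemma isEquivalent_exp_sub_one {α : Type*} {l : Filter α} {f : α → ℂ}
    (hf : Tendsto (fun x => (f x).re) l atTop) :
    (fun x => Complex.exp (f x) - 1) ~[l] fun x => Complex.exp (f x) := by
  rw [IsEquivalent]
  have : ((fun x => Complex.exp (f x) - 1) - fun x => Complex.exp (f x)) = fun _ => (-1 : ℂ) := by
    ext x; simp
  rw [this]
  refine (isLittleO_const_left).2 (Or.inr ?_)
  simp only [Function.comp_def, Complex.norm_exp]
  exact Real.tendsto_exp_atTop.comp hf

lemma u_mul_pi_div_gam (u : ℝ) (n N : ℕ) :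
    (u : ℂ) * π / gam u n N =
      2 * (π : ℂ) * Complex.I * u * ((N : ℂ) + n - 2) / xi u := by
  have h : xi u = Complex.I * (2 * π - Complex.I * u) := by
    rw [xi]; linear_combination (u : ℂ) * Complex.I_sq
  rw [h, gam, div_div_eq_mul_div]
  rw [show 2 * (π : ℂ) * Complex.I * u * ((N : ℂ) + n - 2) =
    Complex.I * (u * π * (2 * ((N : ℂ) + n - 2))) by ring,
    mul_div_mul_left _ _ Complex.I_ne_zero]

lemma re_u_mul_pi_div_gam (u : ℝ) (n N : ℕ) :
    ((u : ℂ) * π / gam u n N).re =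
      (u * π / ((2 * π - Complex.I * u : ℂ))).re * 2 * ((N : ℝ) + ((n : ℝ) - 2)) := by
  have : (u : ℂ) * π / gam u n N =
      (u * π / ((2 * π - Complex.I * u : ℂ))) * ((2 * ((N : ℝ) + ((n : ℝ) - 2)) : ℝ) : ℂ) := by
    rw [gam]; push_cast; rw [div_div_eq_mul_div]; ring
  rw [this, Complex.re_mul_ofReal]; ring

lemma re_u_mul_pi_div_pos {u : ℝ} (hu : 0 < u) : 0 < (u * π / ((2 * π - Complex.I * u : ℂ))).re := by
  have h0 : (2 * π - Complex.I * u : ℂ) ≠ 0 := by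
    intro h; have := congrArg Complex.im h; simp at this; exact hu.ne' this
  have hn := Complex.normSq_pos.2 h0
  have hp := Real.pi_pos
  rw [Complex.div_re]
  simp
  positivity

/-! ### The exact quotient and its asymptotics -/

theorem defined_and_quotient_eq (n : ℕ) (hn : Even n) (hn2 : 2 ≤ n) (u : ℝ) (N : ℕ) (hu : 0 < u)
    (hN : 1 ≤ N) (R R' : ℝ) (hR : AdmissibleRadius (gam u n N) R)
    (hR' : AdmissibleRadius (gam u n N) R') :
    DefinedAt R (gam u n N) (numArg u n N) ∧ DefinedAt R' (gam u n N) (denArg u n N) ∧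
      S R (gam u n N) (numArg u n N) / S R' (gam u n N) (denArg u n N) =
        (Complex.exp ((u : ℂ) * (π : ℂ) / gam u n N) - 1) /
          ∏ k ∈ Finset.range (n - 1),
            (Complex.exp ((u : ℂ) - 2 * (k : ℂ) * gam u n N * Complex.I) - 1) := by
  set γ := gam u n N with hγdef
  have hπ := Real.pi_pos
  have hn2' : (2 : ℝ) ≤ n := by exact_mod_cast hn2
  have hN' : (1 : ℝ) ≤ N := by exact_mod_cast hN
  have hD : 0 < (N : ℝ) + n - 2 := by linarith
  have hre : γ.re = π / ((N : ℝ) + n - 2) := gam_re u n N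
  have hγ : 0 < γ.re := by rw [hre]; positivity
  -- Here `N ≥ 1` enters: `n - 2 < N + n - 2`. This places the denominator's argument in the strip
  -- and permits `n - 1` steps of the ladder.
  have hm : ((n : ℝ) - 2) * γ.re < π := by
    rw [hre, ← mul_div_assoc, div_lt_iff₀ hD, mul_comm]
    nlinarith
  have hγ0 := ne_zero_of_re_pos hγ
  have hnum : |(numArg u n N).re| < π + γ.re := by
    rw [numArg, ← hγdef, abs_lt]; simp; constructor <;> linarith
  have hden : |(denArg u n N).re| < π + γ.re := by
    rw [denArg, ← hγdef, abs_lt]; simp; constructor <;> nlinarith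
  refine ⟨⟨hnum, contourIntegrable_integrand hγ hR hnum⟩,
    ⟨hden, contourIntegrable_integrand hγ hR' hden⟩, ?_⟩
  obtain ⟨h, h0, h1, h2, h3, h4⟩ := exists_line_height hγ hR hR'
  have hcast : ((n - 1 : ℕ) : ℝ) = n - 1 := by
    rw [Nat.cast_sub (by omega)]; simp
  have hcastc : ((n - 1 : ℕ) : ℂ) = n - 1 := by
    rw [Nat.cast_sub (by omega)]; simp
  have key := lineS_quotient hγ (v := -(Complex.I * u)) (by simp) h0 h1 h2 (n - 1)
    (by rw [hcast]; linarith) (by omega)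
  have e1 : -π + -(Complex.I * u) + γ = numArg u n N := by rw [numArg]; ring
  have e2 : π + -(Complex.I * u) - (2 * ((n - 1 : ℕ) : ℂ) - 1) * γ = denArg u n N := by
    rw [denArg, hcastc]; ring
  rw [e1, e2, ← S_eq_lineS hγ hR h0 h1 h2 h3 hnum, ← S_eq_lineS hγ hR' h0 h1 h2 h4 hden] at key
  have e3 : Complex.exp ((-(Complex.I * u) + γ) * pole γ) = -Complex.exp (u * π / γ) := by
    have : (-(Complex.I * u) + γ) * pole γ = u * π / γ + π * Complex.I := by
      rw [pole]
      field_simp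
      linear_combination (-(u : ℂ)) * Complex.I_sq
    rw [this, Complex.exp_add, Complex.exp_pi_mul_I]; ring
  have e4 : ∀ k : ℕ, (1 + Complex.exp ((π + -(Complex.I * u) - 2 * k * γ) * Complex.I)) =
      -(Complex.exp ((u : ℂ) - 2 * (k : ℂ) * γ * Complex.I) - 1) := by
    intro k
    have : (π + -(Complex.I * u) - 2 * k * γ) * Complex.I =
        ((u : ℂ) - 2 * (k : ℂ) * γ * Complex.I) + π * Complex.I := by
      linear_combination (-(u : ℂ)) * Complex.I_sq
    rw [this, Complex.exp_add, Complex.exp_pi_mul_I]; ring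
  -- The product contributes `(-1)^{n-1} = -1`, matching the sign of `1 - e^{uπ/γ}`.
  have hodd : Odd (n - 1) := Nat.Even.sub_odd (by omega) hn odd_one
  simp_rw [e4] at key
  rw [e3, Finset.prod_neg, Finset.card_range, hodd.neg_one_pow] at key
  have hP : ∏ k ∈ Finset.range (n - 1),
      (Complex.exp ((u : ℂ) - 2 * (k : ℂ) * γ * Complex.I) - 1) ≠ 0 := by
    -- Each exponent has real part `u (1 - k / (N + n - 2))`, positive since `k ≤ n - 2` and `N ≥
    -- 1`.
    refine Finset.prod_ne_zero_iff.2 fun k hk => exp_sub_one_ne_zero ?_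
    have hk' : (k : ℝ) ≤ n - 2 := by
      have : k + 2 ≤ n := by have := Finset.mem_range.1 hk; omega
      have : (k : ℝ) + 2 ≤ n := by exact_mod_cast this
      linarith
    have e : ((u : ℂ) - 2 * (k : ℂ) * γ * Complex.I).re =
        u * ((N : ℝ) + n - 2 - k) / ((N : ℝ) + n - 2) := by
      have : ((u : ℂ) - 2 * (k : ℂ) * γ * Complex.I).re = u + 2 * k * γ.im := by simp
      rw [this, hγdef, gam_im]
      field_simp
      ring
    rw [e]
    exact div_pos (mul_pos hu (by linarith)) hD
  rw [div_eq_div_iff (S_ne_zero _ _ _) hP]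
  linear_combination -key

end QDilog

theorem lemma2p7 (n : ℕ) (hn : Even n) (hn2 : 2 ≤ n) (u : ℝ) (hu : 0 < u) :
    (∀ N : ℕ, 1 ≤ N → ∀ R R' : ℝ,
      QDilog.AdmissibleRadius (QDilog.gam u n N) R →
      QDilog.AdmissibleRadius (QDilog.gam u n N) R' →
        QDilog.DefinedAt R (QDilog.gam u n N) (QDilog.numArg u n N) ∧
        QDilog.DefinedAt R' (QDilog.gam u n N) (QDilog.denArg u n N) ∧
        QDilog.S R (QDilog.gam u n N) (QDilog.numArg u n N) /
            QDilog.S R' (QDilog.gam u n N) (QDilog.denArg u n N) =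
          (Complex.exp ((u : ℂ) * (π : ℂ) / QDilog.gam u n N) - 1) /
            ∏ k ∈ Finset.range (n - 1),
              (Complex.exp ((u : ℂ) - 2 * (k : ℂ) * QDilog.gam u n N * Complex.I) - 1)) ∧
    (∀ R R' : ℕ → ℝ,
      (∀ᶠ N : ℕ in atTop, QDilog.AdmissibleRadius (QDilog.gam u n N) (R N) ∧
        QDilog.AdmissibleRadius (QDilog.gam u n N) (R' N)) →
      (fun N : ℕ => QDilog.S (R N) (QDilog.gam u n N) (QDilog.numArg u n N) /
          QDilog.S (R' N) (QDilog.gam u n N) (QDilog.denArg u n N)) ~[atTop]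
        (fun N : ℕ =>
          Complex.exp (2 * (π : ℂ) * Complex.I * (u : ℂ) * ((N : ℂ) + (n : ℂ) - 2) / QDilog.xi u) /
            (Complex.exp (u : ℂ) - 1) ^ (n - 1))) := by
  refine ⟨fun N hN R R' hR hR' =>
    QDilog.defined_and_quotient_eq n hn hn2 u N hu hN R R' hR hR', fun R R' hRR => ?_⟩
  have heq : (fun N : ℕ => (Complex.exp ((u : ℂ) * (π : ℂ) / QDilog.gam u n N) - 1) /
            ∏ k ∈ Finset.range (n - 1),
              (Complex.exp ((u : ℂ) - 2 * (k : ℂ) * QDilog.gam u n N * Complex.I) - 1))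
      =ᶠ[atTop] (fun N : ℕ => QDilog.S (R N) (QDilog.gam u n N) (QDilog.numArg u n N) /
          QDilog.S (R' N) (QDilog.gam u n N) (QDilog.denArg u n N)) := by
    filter_upwards [hRR, eventually_ge_atTop 1] with N hN h1
    exact (QDilog.defined_and_quotient_eq n hn hn2 u N hu h1 _ _ hN.1 hN.2).2.2.symm
  refine IsEquivalent.congr_left ?_ heq
  -- Since `ξ = i(2π - iu)`, the claimed exponent equals `uπ/γ` for every `N`, so numerator and
  -- denominator can be treated separately.
  simp_rw [← QDilog.u_mul_pi_div_gam]
  refine IsEquivalent.div (QDilog.isEquivalent_exp_sub_one ?_) ?_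
  · simp_rw [QDilog.re_u_mul_pi_div_gam]
    exact (tendsto_atTop_add_const_right _ _ tendsto_natCast_atTop_atTop).const_mul_atTop
      (mul_pos (QDilog.re_u_mul_pi_div_pos hu) two_pos)
  · have hne : (Complex.exp (u : ℂ) - 1) ^ (n - 1) ≠ 0 :=
      pow_ne_zero _ (QDilog.exp_sub_one_ne_zero (by simpa using hu))
    refine (isEquivalent_const_iff_tendsto hne).2 ?_
    have hcont : Continuous fun g : ℂ => ∏ k ∈ Finset.range (n - 1),
        (Complex.exp ((u : ℂ) - 2 * (k : ℂ) * g * Complex.I) - 1) := by fun_prop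
    have := (hcont.tendsto 0).comp (QDilog.tendsto_gam u n)
    simpa [Function.comp_def] using this
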